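/- Let $A=(a_1,\dots,a_n)$ be a finite configuration of points of $\mathbb R^d$, possibly repeated or affinely dependent, whose affine span is $\mathbb R^d$. Put $v_i=(a_i,1)\in\mathbb R^{d+1}$ and $Z(V)=\sum_{i=1}^n[0,v_i]$. For disjoint $I,B\subseteq[n]$ such that $(a_b)_{b\in B}$ are $d+1$ affinely independent points, let $\Pi_{I,B}=\sum_{i\in I}v_i+\sum_{b\in B}[0,v_b]$. For $C\subseteq B$ and $J$ disjoint from $C$ with $I\subseteq J\subseteq I\sqcup B$, the parallelepiped $\Pi_{J,C}$ (defined by the same formula) is a face of $\Pi_{I,B}$, with label $(J,C)$. A fine zonotopal tiling $\mathcal P$ of $Z(V)$ is a collection of labelled tiles $\Pi_{I,B}$ whose union is $Z(V)$ and such that any two of them are either disjoint or intersect in a common face, carrying the same label $(J,C)$ in both tiles. For $X\subseteq[n]$ with $|X|=k+d+1$, the spline $M(x\,|\,(a_i)_{i\in X})$ of degree $k$ is defined as follows. It is $0$ if no $d+1$ of the points $(a_i)_{i\in X}$ are affinely independent. Otherwise, it is $\frac{d!}{\det(X)}\mathbf 1_{\mathrm{ch}(\{a_i\}_{i\in X})}(x)$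 if $k=0$, and if $k\ge1$ it is $$\frac{k+d}{k}\sum_{b\in B}\frac{\det(B;b\to x)}{\det(B)}\,M(x\,|\,(a_i)_{i\in X\setminus\{b\}}),$$ where $B=B(X)\subseteq X$ is any choice of $d+1$ indices with affinely independent points. Here $\det(B)=\det((a_b,1)_{b\in B})$ with the rows ordered so that it is positive, and in $\det(B;b\to x)$ the row $(a_b,1)$ is replaced by $(x,1)$. Let $K\subset\mathbb R^d$ be the union of the convex hulls of all subconfigurations of at most $d$ points of $A$ (the knots). Let $k\ge0$, let $\mathcal P$ be any fine zonotopal tiling of $Z(V)$, and assume that each vertex of $\mathrm{ch}(A)$ is repeated at least $k+1$ times in $A$. Then the splines $M(\cdot\,|\,(a_i)_{i\in I\sqcup B})$, for $\Pi_{I,B}\in\mathcal P$ with $|I|=k$, reproduce polynomials of degree at most $k$ on the whole of $\mathrm{ch}(A)$. Precisely, $K$ has Lebesgue measure zero and $\mathrm{ch}(A)\setminus K$ is dense in $\mathrm{ch}(A)$. Moreover, every real polynomial $q$ in $d$ variables of degree at most $k$ has a polar form $Q$ (a function of $k$ points of $\mathbb R^d$ that is symmetric, affine in each argument, and satisfies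 $Q(x,\dots,x)=q(x)$) such that $$q(x)=\frac{k!}{(k+d)!}\sum_{\Pi_{I,B}\in\mathcal P,\ |I|=k}Q((a_i)_{i\in I})\,\mathrm{vol}^{d+1}(\Pi_{I,B})\,M(x\,|\,(a_i)_{i\in I\sqcup B})\qquad\text{for all }x\in\mathrm{ch}(A)\setminus K,$$ and at every point $x\in\mathrm{ch}(A)$, boundary and knots included, the right-hand side, evaluated at points of $\mathrm{ch}(A)\setminus K$ tending to $x$, tends to $q(x)$. -/

import Mathlib

open scoped Pointwise

/-- The projective lift `(a, 1) ∈ ℝ^{d+1}` of a point `a ∈ ℝ^d`. -/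
def projLift {d : ℕ} (p : Fin d → ℝ) : Fin (d + 1) → ℝ :=
  Fin.snoc (α := fun _ => ℝ) p 1

/-- The points `(a_b)_{b ∈ B}` are `d + 1` affinely independent points of `ℝ^d`. -/
def IsAffBasis {d n : ℕ} (a : Fin n → Fin d → ℝ) (B : Finset (Fin n)) : Prop :=
  B.card = d + 1 ∧ AffineIndependent ℝ (fun b : B => a b)

/-- The determinant of the rows `(a_b, 1)`, `b ∈ B`, taken in increasing order of `b`
(only used for `|B| = d + 1`). -/
noncomputable def rowDet {d n : ℕ} (a : Fin n → Fin d → ℝ) (B : Finset (Fin n)) : ℝ :=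
  if h : B.card = d + 1 then
    Matrix.det (Matrix.of fun j : Fin (d + 1) => projLift (a (B.orderEmbOfFin h j)))
  else 0

/-- The determinant of the rows `(a_b, 1)`, `b ∈ B`, ordered so that it is positive. -/
noncomputable def detPos {d n : ℕ} (a : Fin n → Fin d → ℝ) (B : Finset (Fin n)) : ℝ :=
  |rowDet a B|

/-- The result of replacing the row `(a_b, 1)` by `(x, 1)` in the determinant `detPos a B`, all rows
keeping the order that makes `detPos a B` positive. -/
noncomputable def detReplace {d n : ℕ} (a : Fin n → Fin d → ℝ) (B : Finset (Fin n)) (b : Fin n)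
    (x : Fin d → ℝ) : ℝ :=
  Real.sign (rowDet a B) * rowDet (Function.update a b x) B

/-- `β` selects, from each index set `X` whose points affinely span `ℝ^d`, a subset `β X` indexing
`d + 1` affinely independent points. -/
def IsBasisChoice {d n : ℕ} (a : Fin n → Fin d → ℝ) (β : Finset (Fin n) → Finset (Fin n)) : Prop :=
  ∀ X : Finset (Fin n), (∃ B ⊆ X, IsAffBasis a B) → β X ⊆ X ∧ IsAffBasis a (β X)

open Classical in
/-- The normalized multivariate spline `M(x | (a_i)_{i ∈ X})` of degree `k`, where `|X| = k + d + 1`,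
given by its recurrence; `β X` is the subset `B ⊆ X` used in the recurrence at `X`. -/
noncomputable def simplexSpline {d n : ℕ} (a : Fin n → Fin d → ℝ)
    (β : Finset (Fin n) → Finset (Fin n)) : ℕ → Finset (Fin n) → (Fin d → ℝ) → ℝ
  | 0, X, x =>
    if IsAffBasis a X then
      (d.factorial : ℝ) / detPos a X *
        Set.indicator (convexHull ℝ (a '' (X : Set (Fin n)))) (fun _ => (1 : ℝ)) x
    else 0
  | k + 1, X, x =>
    if ∃ B ⊆ X, IsAffBasis a B then
      (((k + 1 : ℕ) : ℝ) + d) / ((k + 1 : ℕ) : ℝ) *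
        ∑ b ∈ β X, detReplace a (β X) b x / detPos a (β X) * simplexSpline a β k (X.erase b) x
    else 0

/-- The zonotope `Z(V) = ∑_i [0, v_i]` of the lifted configuration `v_i = (a_i, 1)`. -/
def zonotope {d n : ℕ} (a : Fin n → Fin d → ℝ) : Set (Fin (d + 1) → ℝ) :=
  ∑ i : Fin n, segment ℝ 0 (projLift (a i))

/-- `Π_{I,B} = ∑_{i ∈ I} v_i + ∑_{b ∈ B} [0, v_b]`. -/
def tileSet {d n : ℕ} (a : Fin n → Fin d → ℝ) (I B : Finset (Fin n)) : Set (Fin (d + 1) → ℝ) :=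
  {∑ i ∈ I, projLift (a i)} + ∑ b ∈ B, segment ℝ 0 (projLift (a b))

/-- `Π_{J,C}` is one of the faces of `Π_{I,B}`: for `b ∈ B \ C` the coefficient of `v_b` is set to
`1` if `b ∈ J` and to `0` if `b ∉ J`. -/
def IsTileFace {n : ℕ} (J C I B : Finset (Fin n)) : Prop :=
  C ⊆ B ∧ I ⊆ J ∧ J ⊆ I ∪ B ∧ Disjoint J C

/-- A fine zonotopal tiling of `Z(V)`. Tiles and faces carry their labels `(I, B)`: different index
sets may describe the same subset of `ℝ^{d+1}`, so a common face has to be a face of both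
tiles with the same label. -/
structure IsFineZonotopalTiling {d n : ℕ} (a : Fin n → Fin d → ℝ)
    (P : Finset (Finset (Fin n) × Finset (Fin n))) : Prop where
  tile : ∀ t ∈ P, Disjoint t.1 t.2 ∧ IsAffBasis a t.2
  cover : (⋃ t ∈ P, tileSet a t.1 t.2) = zonotope a
  inter : ∀ s ∈ P, ∀ t ∈ P, (tileSet a s.1 s.2 ∩ tileSet a t.1 t.2).Nonempty →
    ∃ J C : Finset (Fin n), IsTileFace J C s.1 s.2 ∧ IsTileFace J C t.1 t.2 ∧
      tileSet a s.1 s.2 ∩ tileSet a t.1 t.2 = tileSet a J C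

/-- `Q` is the polar form of `q`, as a polynomial of degree at most `k`: symmetric, affine in each
of its `k` arguments, and equal to `q` on the diagonal. -/
structure IsPolarForm {d : ℕ} (k : ℕ) (q : MvPolynomial (Fin d) ℝ)
    (Q : (Fin k → Fin d → ℝ) → ℝ) : Prop where
  symm : ∀ (σ : Equiv.Perm (Fin k)) (p : Fin k → Fin d → ℝ), Q (p ∘ σ) = Q p
  affine : ∀ (p : Fin k → Fin d → ℝ) (j : Fin k) (y z : Fin d → ℝ) (s : ℝ),
    Q (Function.update p j ((1 - s) • y + s • z)) =
      (1 - s) * Q (Function.update p j y) + s * Q (Function.update p j z)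
  diag : ∀ x : Fin d → ℝ, Q (fun _ => x) = MvPolynomial.eval x q

/-- `Q((a_i)_{i ∈ I})` for an index set `I` of size `k` (the value `0` for other `I` is not used). -/
noncomputable def polarAt {d n k : ℕ} (Q : (Fin k → Fin d → ℝ) → ℝ) (a : Fin n → Fin d → ℝ)
    (I : Finset (Fin n)) : ℝ :=
  if h : I.card = k then Q (fun j => a (I.orderEmbOfFin h j)) else 0

/-- The convex hull `ch(A)` of all points. -/
def hull {d n : ℕ} (a : Fin n → Fin d → ℝ) : Set (Fin d → ℝ) :=
  convexHull ℝ (Set.range a)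

/-- The knot set: the union of the convex hulls of at most `d` of the points. Off this set
the value of a spline does not depend on the subsets `B` used in its recurrence. -/
def knotSet {d n : ℕ} (a : Fin n → Fin d → ℝ) : Set (Fin d → ℝ) :=
  ⋃ C : {C : Finset (Fin n) // C.card ≤ d}, convexHull ℝ (a '' (C.1 : Set (Fin n)))

/-- The combination
`k!/(k+d)! ∑_{Π_{I,B} ∈ P, |I| = k} Q((a_i)_{i ∈ I}) vol(Π_{I,B}) M(x | (a_i)_{i ∈ I ⊔ B})`. -/
noncomputable def tileSplineSum {d n : ℕ} (a : Fin n → Fin d → ℝ)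
    (β : Finset (Fin n) → Finset (Fin n)) (P : Finset (Finset (Fin n) × Finset (Fin n))) (k : ℕ)
    (Q : (Fin k → Fin d → ℝ) → ℝ) (x : Fin d → ℝ) : ℝ :=
  (k.factorial : ℝ) / ((k + d).factorial : ℝ) *
    ∑ t ∈ P.filter (fun t => t.1.card = k),
      polarAt Q a t.1 * MeasureTheory.volume.real (tileSet a t.1 t.2) *
        simplexSpline a β k (t.1 ∪ t.2) x

/-! The proof is by induction on `k`. Off the knots, the degree `k + 1` spline recurrence at `X`
holds for every representation of `x` as an affine combination of the points of `X`, so on a tile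
`Π_{I,B}` with `|I| = k + 1` one may use the coordinates of `x` in its own basis `B`. Likewise
`Q(x, ·)` is the combination of the `Q(a_b, ·)` with the coordinates of `x` in the basis `B` of a
tile with `|I| = k`. By Cramer's rule both expansions, of the degree `k + 1` sum for `Q` and of the
degree `k` sum for `Q(x, ·)`, have one term for each pair of a facet `Π_{J,C}` with `|J| = k + 1`
and a tile on it: the product of `Q((a_j)_{j ∈ J})`, `M(x | (a_i)_{i ∈ J ⊔ C})` and, up to the sign
recording the side of the facet on which the tile lies, `det ((a_c)_{c ∈ C}, x)`. Across a facet
with two adjacent tiles these signs cancel. A facet with only one lies on the boundary of the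
zonotope; since fewer than all copies of any vertex of `ch(A)` belong to `J`, this forces the points
of `J ⊔ C` into a hyperplane, where the spline vanishes. For `k = 0`, slicing the zonotope parallel
to its base shows that the tiles `Π_{∅,B}` cut out a triangulation of `ch(A)`. -/

section Signs

lemma sign_add_sign_of_mul_neg {r s : ℝ} (h : r * s < 0) : Real.sign r + Real.sign s = 0 := by
  rcases mul_neg_iff.1 h with ⟨hr, hs⟩ | ⟨hr, hs⟩ <;>
    simp [Real.sign_of_pos, Real.sign_of_neg, hr, hs]

lemma sign_mul_self_eq_abs (r : ℝ) : Real.sign r * r = |r| := by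
  rcases lt_trichotomy r 0 with h | rfl | h
  · simp [Real.sign_of_neg h, abs_of_neg h]
  · simp
  · simp [Real.sign_of_pos h, abs_of_pos h]

lemma sum_sign_eq_zero {ι : Type*} {S : Finset ι} {f : ι → ℝ}
    (hpair : ∀ i ∈ S, ∀ j ∈ S, i ≠ j → f i * f j < 0) (hopp : ∀ i ∈ S, ∃ j ∈ S, f i * f j < 0) :
    ∑ i ∈ S, Real.sign (f i) = 0 := by
  choose g hgS hg using hopp
  refine Finset.sum_involution g (fun i hi => sign_add_sign_of_mul_neg (hg i hi))
    (fun i hi _ h => ?_) hgS fun i hi => by_contra fun h => ?_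
  · have := hg i hi
    rw [h] at this
    exact this.not_ge (mul_self_nonneg _)
  · set j := g i hi
    have hij := hg i hi
    have hjk := hg j (hgS i hi)
    have hki := hpair _ (hgS j (hgS i hi)) i hi h
    rcases mul_neg_iff.1 hij with ⟨hi0, hj0⟩ | ⟨hi0, hj0⟩ <;> nlinarith

lemma sum_sum_eq_zero_of_antisymm {ι : Type*} (S : Finset ι) {f : ι → ι → ℝ}
    (h : ∀ i ∈ S, ∀ j ∈ S, f i j = -f j i) : ∑ i ∈ S, ∑ j ∈ S, f i j = 0 := by
  have hneg : ∑ i ∈ S, ∑ j ∈ S, f i j = -∑ i ∈ S, ∑ j ∈ S, f i j := by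
    conv_lhs => rw [Finset.sum_comm]
    simp only [← Finset.sum_neg_distrib]
    exact Finset.sum_congr rfl fun i hi => Finset.sum_congr rfl fun j hj => h j hj i hi
  linarith

end Signs

section Affine

lemma map_sum_smul_of_affine {E ι : Type*} [AddCommGroup E] [Module ℝ E] {f : E → ℝ}
    (hf : ∀ (y z : E) (s : ℝ), f ((1 - s) • y + s • z) = (1 - s) * f y + s * f z)
    (S : Finset ι) (c : ι → ℝ) (p : ι → E) (hc : ∑ i ∈ S, c i = 1) :
    f (∑ i ∈ S, c i • p i) = ∑ i ∈ S, c i * f (p i) := by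
  have hsmul : ∀ (s : ℝ) (z : E), f (s • z) - f 0 = s * (f z - f 0) := fun s z => by
    have h := hf 0 z s
    rw [smul_zero, zero_add] at h
    rw [h]; ring
  have hadd : ∀ y z : E, f (y + z) - f 0 = (f y - f 0) + (f z - f 0) := fun y z => by
    have h := hsmul 2 ((1 - (1 / 2 : ℝ)) • y + (1 / 2 : ℝ) • z)
    rw [hf, smul_add, smul_smul, smul_smul] at h
    norm_num at h
    rw [h]; ring
  let g : E →ₗ[ℝ] ℝ := { toFun := fun y => f y - f 0, map_add' := hadd, map_smul' := hsmul }
  have hg : f (∑ i ∈ S, c i • p i) - f 0 = ∑ i ∈ S, c i * (f (p i) - f 0) := by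
    have h := map_sum g (fun i => c i • p i) S
    simp only [map_smul] at h
    exact h
  simp only [mul_sub, Finset.sum_sub_distrib, ← Finset.sum_mul, hc, one_mul] at hg
  linarith

end Affine

section NullSets
open MeasureTheory
variable {E : Type*} [NormedAddCommGroup E] [NormedSpace ℝ E] [MeasurableSpace E]

lemma addHaar_convexHull_image_eq_zero [FiniteDimensional ℝ E] [BorelSpace E] {ι : Type*}
    (μ : Measure E) [μ.IsAddHaarMeasure] (p : ι → E) {C : Finset ι}
    (hC : C.card ≤ Module.finrank ℝ E) :
    μ (convexHull ℝ (p '' C)) = 0 := by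
  refine measure_mono_null (convexHull_subset_affineSpan _)
    (Measure.addHaar_affineSubspace μ _ fun htop => ?_)
  rcases C.eq_empty_or_nonempty with rfl | hne
  · rw [Finset.coe_empty, Set.image_empty, AffineSubspace.span_empty] at htop
    exact AffineSubspace.bot_ne_top ℝ E E htop
  · classical
    have hpos := hne.card_pos
    have hle := finrank_vectorSpan_image_finset_le ℝ p C (n := C.card - 1) (by omega)
    rw [Finset.coe_image, ← direction_affineSpan, htop, AffineSubspace.direction_top,
      finrank_top] at hle
    omega

lemma subset_closure_diff_of_convex_of_measure_zero (μ : Measure E) [μ.IsOpenPosMeasure]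
    {s N : Set E} (hs : Convex ℝ s) (hint : (interior s).Nonempty) (hN : μ N = 0) :
    s ⊆ closure (s \ N) :=
  calc s ⊆ closure (interior s) :=
      subset_closure.trans (hs.closure_interior_eq_closure_of_nonempty_interior hint).ge
    _ ⊆ closure (interior s ∩ Nᶜ) :=
      closure_minimal ((Measure.dense_of_ae (compl_mem_ae_iff.2 hN)).open_subset_closure_inter
        isOpen_interior) isClosed_closure
    _ ⊆ closure (s \ N) := closure_mono (Set.inter_subset_inter_left _ interior_subset)

end NullSets

section Lift
variable {d n : ℕ}

@[simp] lemma projLift_last (p : Fin d → ℝ) : projLift p (Fin.last d) = 1 := by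
  simp [projLift]

@[simp] lemma projLift_castSucc (p : Fin d → ℝ) (j : Fin d) : projLift p j.castSucc = p j := by
  simp [projLift]

lemma continuous_projLift : Continuous (projLift (d := d)) :=
  Continuous.finSnoc continuous_id continuous_const

lemma projLift_smul_add_smul {s t : ℝ} (hst : s + t = 1) (p q : Fin d → ℝ) :
    projLift (s • p + t • q) = s • projLift p + t • projLift q := by
  ext j
  induction j using Fin.lastCases <;> simp [hst]

lemma sum_smul_projLift_eq_iff {ι : Type*} (S : Finset ι) (c : ι → ℝ) (p : ι → Fin d → ℝ)
    (y : Fin (d + 1) → ℝ) :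
    ∑ i ∈ S, c i • projLift (p i) = y ↔
      ∑ i ∈ S, c i • p i = (fun j => y j.castSucc) ∧ ∑ i ∈ S, c i = y (Fin.last d) := by
  refine ⟨?_, fun ⟨hp, hc⟩ => ?_⟩
  · rintro rfl
    exact ⟨by ext j; simp, by simp⟩
  · ext j
    induction j using Fin.lastCases with
    | last => simpa using hc
    | cast j => simpa using congrFun hp j

lemma isAffBasis_iff (a : Fin n → Fin d → ℝ) (B : Finset (Fin n)) :
    IsAffBasis a B ↔ B.card = d + 1 ∧ LinearIndependent ℝ (fun b : B => projLift (a b)) := by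
  refine and_congr_right fun _ => ?_
  rw [affineIndependent_iff, linearIndependent_iff']
  refine forall_congr' fun S => forall_congr' fun w => ?_
  rw [sum_smul_projLift_eq_iff, and_comm, and_imp]
  rfl

/-- The linear map `ℝⁿ → ℝ^{d+1}`, `c ↦ ∑ i, c i • v_i`, under which the zonotope and its tiles are
the images of the unit cube and of some of its faces. -/
noncomputable def liftComb (a : Fin n → Fin d → ℝ) : (Fin n → ℝ) →ₗ[ℝ] (Fin (d + 1) → ℝ) :=
  Fintype.linearCombination ℝ fun i => projLift (a i)

lemma liftComb_apply (a : Fin n → Fin d → ℝ) (c : Fin n → ℝ) :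
    liftComb a c = ∑ i, c i • projLift (a i) := rfl

lemma continuous_liftComb (a : Fin n → Fin d → ℝ) : Continuous (liftComb a) :=
  (liftComb a).continuous_of_finiteDimensional

@[simp] lemma liftComb_single (a : Fin n → Fin d → ℝ) (i : Fin n) (r : ℝ) :
    liftComb a (Pi.single i r) = r • projLift (a i) := by
  simp [liftComb]

lemma map_liftComb (L : (Fin (d + 1) → ℝ) →ₗ[ℝ] ℝ) (a : Fin n → Fin d → ℝ) (c : Fin n → ℝ) :
    L (liftComb a c) = ∑ i, c i * L (projLift (a i)) := by
  simp [liftComb_apply]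

lemma liftComb_eq_projLift_iff {a : Fin n → Fin d → ℝ} {c : Fin n → ℝ} {x : Fin d → ℝ} :
    liftComb a c = projLift x ↔ ∑ i, c i • a i = x ∧ ∑ i, c i = 1 := by
  simp [liftComb_apply, sum_smul_projLift_eq_iff]

/-- `c` represents `y ∈ ℝ^{d+1}` as a linear combination of the lifts `v_i`, `i ∈ X`; for
`y = (x, 1)` these are the affine coordinates of `x` with respect to the points `a_i`, `i ∈ X`. -/
structure IsLiftRep (a : Fin n → Fin d → ℝ) (X : Finset (Fin n)) (c : Fin n → ℝ)
    (y : Fin (d + 1) → ℝ) : Prop where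
  zero_of_notMem : ∀ i ∉ X, c i = 0
  map_eq : liftComb a c = y

namespace IsLiftRep
variable {a : Fin n → Fin d → ℝ} {X Y : Finset (Fin n)} {c c' : Fin n → ℝ}
  {y y' : Fin (d + 1) → ℝ}

lemma mono (h : IsLiftRep a X c y) (hXY : X ⊆ Y) : IsLiftRep a Y c y :=
  ⟨fun i hi => h.1 i fun hX => hi (hXY hX), h.2⟩

lemma erase (h : IsLiftRep a X c y) {j : Fin n} (hj : c j = 0) : IsLiftRep a (X.erase j) c y := by
  refine ⟨fun i hi => ?_, h.2⟩
  rcases eq_or_ne i j with rfl | hij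
  · exact hj
  · exact h.1 i fun hX => hi (Finset.mem_erase.2 ⟨hij, hX⟩)

lemma add (h : IsLiftRep a X c y) (h' : IsLiftRep a X c' y') :
    IsLiftRep a X (c + c') (y + y') :=
  ⟨fun i hi => by simp [h.1 i hi, h'.1 i hi], by rw [map_add, h.2, h'.2]⟩

lemma sub (h : IsLiftRep a X c y) (h' : IsLiftRep a X c' y') :
    IsLiftRep a X (c - c') (y - y') :=
  ⟨fun i hi => by simp [h.1 i hi, h'.1 i hi], by rw [map_sub, h.2, h'.2]⟩

lemma smul (r : ℝ) (h : IsLiftRep a X c y) : IsLiftRep a X (r • c) (r • y) :=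
  ⟨fun i hi => by simp [h.1 i hi], by rw [map_smul, h.2]⟩

lemma sum_eq {M : Type*} [AddCommMonoid M] [Module ℝ M] (h : IsLiftRep a X c y) (f : Fin n → M) :
    ∑ i ∈ X, c i • f i = ∑ i, c i • f i :=
  Finset.sum_subset (Finset.subset_univ X) fun i _ hi => by simp [h.1 i hi]

end IsLiftRep

lemma isLiftRep_single (a : Fin n → Fin d → ℝ) (i : Fin n) (r : ℝ) :
    IsLiftRep a {i} (Pi.single i r) (r • projLift (a i)) :=
  ⟨fun j hj => by simp [Finset.notMem_singleton.1 hj], by simp⟩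

section Hull
variable {a : Fin n → Fin d → ℝ} {X B : Finset (Fin n)} {x : Fin d → ℝ}

lemma mem_convexHull_image_iff :
    x ∈ convexHull ℝ (a '' (X : Set (Fin n))) ↔ ∃ c, 0 ≤ c ∧ IsLiftRep a X c (projLift x) := by
  constructor
  · refine fun hx => convexHull_min (t := {x | ∃ c, 0 ≤ c ∧ IsLiftRep a X c (projLift x)})
      ?_ ?_ hx
    · rintro _ ⟨i, hi, rfl⟩
      exact ⟨Pi.single i 1, Pi.single_nonneg.2 zero_le_one,
        one_smul ℝ (projLift (a i)) ▸
          (isLiftRep_single a i 1).mono (Finset.singleton_subset_iff.2 hi)⟩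
    · rintro y ⟨c, hc, hcy⟩ z ⟨c', hc', hcz⟩ s t hs ht hst
      exact ⟨s • c + t • c', add_nonneg (smul_nonneg hs hc) (smul_nonneg ht hc'),
        projLift_smul_add_smul hst y z ▸ (hcy.smul s).add (hcz.smul t)⟩
  · rintro ⟨c, hc, hcx⟩
    obtain ⟨hx, hc1⟩ := liftComb_eq_projLift_iff.1 hcx.map_eq
    rw [← hx, ← hcx.sum_eq]
    refine (convex_convexHull ℝ _).sum_mem (fun i _ => hc i) ?_
      fun i hi => subset_convexHull ℝ _ ⟨i, hi, rfl⟩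
    simpa [hc1] using hcx.sum_eq fun _ => (1 : ℝ)

lemma hull_eq (a : Fin n → Fin d → ℝ) :
    hull a = convexHull ℝ (a '' ((Finset.univ : Finset (Fin n)) : Set (Fin n))) := by
  simp [hull]

lemma card_lt_of_notMem_knotSet (hx : x ∉ knotSet a)
    (hX : x ∈ convexHull ℝ (a '' (X : Set (Fin n)))) : d < X.card :=
  not_le.1 fun hcard => hx (Set.mem_iUnion.2 ⟨⟨X, hcard⟩, hX⟩)

lemma pos_of_notMem_knotSet (hx : x ∉ knotSet a) (hX : X.card ≤ d + 1) {c : Fin n → ℝ}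
    (hc : 0 ≤ c) (hcx : IsLiftRep a X c (projLift x)) {i : Fin n} (hi : i ∈ X) : 0 < c i := by
  refine (hc i).lt_of_ne fun h => ?_
  have hlt := card_lt_of_notMem_knotSet hx
    (mem_convexHull_image_iff.2 ⟨c, hc, hcx.erase h.symm⟩)
  rw [Finset.card_erase_of_mem hi] at hlt
  omega

end Hull

namespace IsAffBasis
variable {a : Fin n → Fin d → ℝ} {B : Finset (Fin n)}

lemma eq_zero (hB : IsAffBasis a B) {c : Fin n → ℝ} (hc : IsLiftRep a B c 0) : c = 0 := by
  have h0 : ∑ b : B, c b • projLift (a b) = 0 := by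
    rw [Finset.sum_coe_sort B fun i => c i • projLift (a i), hc.sum_eq, ← liftComb_apply, hc.map_eq]
  ext i
  by_cases hi : i ∈ B
  · exact Fintype.linearIndependent_iff.1 ((isAffBasis_iff a B).1 hB).2 (fun b => c b) h0 ⟨i, hi⟩
  · exact hc.zero_of_notMem i hi

lemma exists_isLiftRep (hB : IsAffBasis a B) (y : Fin (d + 1) → ℝ) : ∃ c, IsLiftRep a B c y := by
  obtain ⟨hcard, hli⟩ := (isAffBasis_iff a B).1 hB
  have hspan := hli.span_eq_top_of_card_eq_finrank' (by simp [hcard])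
  obtain ⟨w, rfl⟩ := (Submodule.mem_span_range_iff_exists_fun ℝ).1
    (hspan ▸ Submodule.mem_top : y ∈ Submodule.span ℝ (Set.range fun b : B => projLift (a b)))
  refine ⟨∑ b : B, Pi.single (b : Fin n) (w b), fun i hi => ?_, by simp⟩
  rw [Finset.sum_apply]
  exact Finset.sum_eq_zero fun b _ => Pi.single_eq_of_ne (ne_of_mem_of_not_mem b.2 hi).symm _

lemma exists_map_projLift_ne_zero (hB : IsAffBasis a B) {L : (Fin (d + 1) → ℝ) →ₗ[ℝ] ℝ}
    (hL : L ≠ 0) : ∃ b ∈ B, L (projLift (a b)) ≠ 0 := by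
  by_contra! h
  refine hL (LinearMap.ext fun y => ?_)
  obtain ⟨c, hc⟩ := hB.exists_isLiftRep y
  rw [← hc.map_eq, map_liftComb]
  refine Finset.sum_eq_zero fun i _ => ?_
  by_cases hi : i ∈ B
  · rw [h i hi, mul_zero]
  · rw [hc.zero_of_notMem i hi, zero_mul]

end IsAffBasis

end Lift

section Det
variable {d n : ℕ} {a : Fin n → Fin d → ℝ} {B C : Finset (Fin n)} {b : Fin n}

lemma exists_perm_orderEmbOfFin {m : ℕ} (hB : B.card = m) (e : Fin m → Fin n)
    (he : Function.Injective e) (heB : ∀ j, e j ∈ B) :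
    ∃ σ : Equiv.Perm (Fin m), ∀ j, B.orderEmbOfFin hB (σ j) = e j := by
  let f : Fin m → Fin m := fun j => (B.orderIsoOfFin hB).symm ⟨e j, heB j⟩
  have hf : Function.Injective f := fun i j h => he (by simpa [f] using h)
  exact ⟨Equiv.ofBijective f (Finite.injective_iff_bijective.1 hf), fun j => by
    simp [f, ← Finset.coe_orderIsoOfFin_apply]⟩

lemma exists_rowDet_eq (hB : B.card = d + 1) (e : Fin (d + 1) → Fin n)
    (he : Function.Injective e) (heB : ∀ j, e j ∈ B) :
    ∃ ε : ℝ, (ε = 1 ∨ ε = -1) ∧ ∀ a : Fin n → Fin d → ℝ,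
      rowDet a B = ε * Matrix.det (Matrix.of fun j => projLift (a (e j))) := by
  obtain ⟨σ, hσ⟩ := exists_perm_orderEmbOfFin hB e he heB
  refine ⟨((Equiv.Perm.sign σ : ℤ) : ℝ), ?_, fun a => ?_⟩
  · rcases Int.units_eq_one_or (Equiv.Perm.sign σ) with h | h <;> simp [h]
  · set M := Matrix.of fun j : Fin (d + 1) => projLift (a (B.orderEmbOfFin hB j))
    have hperm : M.submatrix σ id = Matrix.of fun j => projLift (a (e j)) := by
      ext i j
      simp [M, hσ]
    rw [rowDet, dif_pos hB, ← hperm, Matrix.det_permute, ← mul_assoc, ← Int.cast_mul,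
      ← Units.val_mul]
    simp [M]

lemma rowDet_ne_zero_iff : rowDet a B ≠ 0 ↔ IsAffBasis a B := by
  rw [isAffBasis_iff]
  by_cases hB : B.card = d + 1
  · rw [rowDet, dif_pos hB, ← isUnit_iff_ne_zero, ← Matrix.isUnit_iff_isUnit_det,
      ← Matrix.linearIndependent_rows_iff_isUnit, and_iff_right hB,
      ← linearIndependent_equiv (B.orderIsoOfFin hB).toEquiv]
    rfl
  · simp [rowDet, hB]

lemma IsAffBasis.detPos_pos (hB : IsAffBasis a B) : 0 < detPos a B :=
  abs_pos.2 (rowDet_ne_zero_iff.2 hB)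

/-- The linear functional `y ↦ det (v_c, y)` with last row `y`, which vanishes on the hyperplane
spanned by the lifts of the `d` points indexed by `C`; it is `0` when `|C| ≠ d`. -/
noncomputable def facetFunctional (a : Fin n → Fin d → ℝ) (C : Finset (Fin n)) :
    (Fin (d + 1) → ℝ) →ₗ[ℝ] ℝ :=
  if h : C.card = d then
    (Matrix.detRowAlternating (R := ℝ) (n := Fin (d + 1))).toMultilinearMap.toLinearMap
      (Fin.snoc (α := fun _ => Fin (d + 1) → ℝ) (fun j => projLift (a (C.orderEmbOfFin h j))) 0)
      (Fin.last d)
  else 0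

lemma facetFunctional_apply (a : Fin n → Fin d → ℝ) (h : C.card = d) (y : Fin (d + 1) → ℝ) :
    facetFunctional a C y = Matrix.det (Matrix.of (Fin.snoc (α := fun _ => Fin (d + 1) → ℝ)
      (fun j => projLift (a (C.orderEmbOfFin h j))) y)) := by
  rw [facetFunctional, dif_pos h]
  simp only [MultilinearMap.toLinearMap_apply, Fin.update_snoc_last]
  rfl

lemma facetFunctional_of_mem (a : Fin n → Fin d → ℝ) (hb : b ∈ C) :
    facetFunctional a C (projLift (a b)) = 0 := by
  by_cases h : C.card = d
  · obtain ⟨j, rfl⟩ : b ∈ Set.range (C.orderEmbOfFin h) := by simpa using hb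
    rw [facetFunctional_apply a h]
    refine Matrix.det_zero_of_row_eq (Fin.castSucc_lt_last j).ne ?_
    ext i
    simp
  · simp [facetFunctional, h]

lemma facetFunctional_update (a : Fin n → Fin d → ℝ) (hb : b ∉ C) (x : Fin d → ℝ) :
    facetFunctional (Function.update a b x) C = facetFunctional a C := by
  by_cases h : C.card = d
  · have hne : ∀ j, C.orderEmbOfFin h j ≠ b := fun j =>
      ne_of_mem_of_not_mem (C.orderEmbOfFin_mem h j) hb
    simp only [facetFunctional, Function.update_of_ne (hne _)]
  · simp [facetFunctional, h]

lemma exists_rowDet_insert (d : ℕ) (hb : b ∉ C) :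
    ∃ ε : ℝ, (ε = 1 ∨ ε = -1) ∧ ∀ a : Fin n → Fin d → ℝ,
      rowDet a (insert b C) = ε * facetFunctional a C (projLift (a b)) := by
  by_cases h : C.card = d
  · have hmem : ∀ j, C.orderEmbOfFin h j ∈ C := C.orderEmbOfFin_mem h
    obtain ⟨ε, hε, H⟩ := exists_rowDet_eq (d := d) (B := insert b C)
      (by rw [Finset.card_insert_of_notMem hb, h])
      (Fin.snoc (α := fun _ => Fin n) (C.orderEmbOfFin h) b)
      (Fin.snoc_injective_iff.2
        ⟨(C.orderEmbOfFin h).injective, fun ⟨j, hj⟩ => hb (hj ▸ hmem j)⟩)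
      fun j => by induction j using Fin.lastCases <;> simp [hmem]
    refine ⟨ε, hε, fun a => ?_⟩
    rw [H, facetFunctional_apply a h]
    congr 3
    ext j i
    induction j using Fin.lastCases <;> simp
  · exact ⟨1, .inl rfl, fun a => by simp [rowDet, facetFunctional, h, hb]⟩

lemma detPos_insert (a : Fin n → Fin d → ℝ) (hb : b ∉ C) :
    detPos a (insert b C) = |facetFunctional a C (projLift (a b))| := by
  obtain ⟨ε, rfl | rfl, H⟩ := exists_rowDet_insert d hb <;> simp [detPos, H a]

lemma detReplace_insert (a : Fin n → Fin d → ℝ) (hb : b ∉ C) (x : Fin d → ℝ) :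
    detReplace a (insert b C) b x =
      Real.sign (facetFunctional a C (projLift (a b))) * facetFunctional a C (projLift x) := by
  obtain ⟨ε, rfl | rfl, H⟩ := exists_rowDet_insert d hb <;>
    simp [detReplace, H, facetFunctional_update a hb, Real.sign_neg]

lemma facetFunctional_ne_zero_iff (hb : b ∉ C) :
    facetFunctional a C (projLift (a b)) ≠ 0 ↔ IsAffBasis a (insert b C) := by
  rw [← rowDet_ne_zero_iff, ← abs_pos, ← detPos_insert a hb, detPos, abs_pos]

lemma IsLiftRep.facetFunctional_eq {c : Fin n → ℝ} {y : Fin (d + 1) → ℝ}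
    (hc : IsLiftRep a (insert b C) c y) :
    facetFunctional a C y = c b * facetFunctional a C (projLift (a b)) := by
  rw [← hc.map_eq, map_liftComb]
  refine Finset.sum_eq_single_of_mem b (Finset.mem_univ b) fun i _ hib => ?_
  by_cases hi : i ∈ C
  · rw [facetFunctional_of_mem a hi, mul_zero]
  · rw [hc.zero_of_notMem i (by simp [hib, hi]), zero_mul]

lemma IsLiftRep.detReplace_eq {c : Fin n → ℝ} {x : Fin d → ℝ} (hc : IsLiftRep a B c (projLift x))
    (hb : b ∈ B) : detReplace a B b x = c b * detPos a B := by
  obtain ⟨C, hbC, rfl⟩ : ∃ C, b ∉ C ∧ insert b C = B :=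
    ⟨B.erase b, Finset.notMem_erase b B, Finset.insert_erase hb⟩
  rw [detReplace_insert a hbC, detPos_insert a hbC, hc.facetFunctional_eq, mul_left_comm,
    sign_mul_self_eq_abs]

lemma IsAffBasis.detReplace_div (hB : IsAffBasis a B) {c : Fin n → ℝ} {x : Fin d → ℝ}
    (hc : IsLiftRep a B c (projLift x)) (hb : b ∈ B) :
    detReplace a B b x / detPos a B = c b := by
  rw [hc.detReplace_eq hb, mul_div_cancel_right₀ _ hB.detPos_pos.ne']

end Det

section Circuits
variable {d n : ℕ} {a : Fin n → Fin d → ℝ} {X : Finset (Fin n)} {μ : Fin n → ℝ} {x : Fin d → ℝ}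

lemma IsLiftRep.sum_eq_zero (hμ : IsLiftRep a X μ 0) : ∑ i, μ i = 0 := by
  simpa [liftComb_apply] using congrFun hμ.map_eq (Fin.last d)

lemma exists_neg_mem_convexHull_erase (hx : x ∈ convexHull ℝ (a '' (X : Set (Fin n))))
    (hμ : IsLiftRep a X μ 0) {i : Fin n} (hi : 0 < μ i) :
    ∃ j ∈ X, μ j < 0 ∧ x ∈ convexHull ℝ (a '' (X.erase j : Set (Fin n))) := by
  obtain ⟨c, hc, hcx⟩ := mem_convexHull_image_iff.1 hx
  obtain ⟨l, -, hl⟩ : ∃ l ∈ Finset.univ, μ l < 0 :=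
    (Finset.exists_pos_of_sum_zero_of_exists_nonzero (fun l => -μ l)
      (by rw [Finset.sum_neg_distrib, hμ.sum_eq_zero, neg_zero])
      ⟨i, Finset.mem_univ i, neg_ne_zero.2 hi.ne'⟩).imp fun l hl => ⟨hl.1, neg_pos.1 hl.2⟩
  obtain ⟨j, hj, hmin⟩ := Finset.exists_min_image (Finset.univ.filter fun j => μ j < 0)
    (fun j => c j / -μ j) ⟨l, Finset.mem_filter.2 ⟨Finset.mem_univ l, hl⟩⟩
  simp only [Finset.mem_filter, Finset.mem_univ, true_and] at hj hmin
  -- `c + t • μ` stays nonnegative until the first weight, the one at `j`, vanishes.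
  set t := c j / -μ j
  have ht : 0 ≤ t := div_nonneg (hc j) (by linarith)
  have hnonneg : 0 ≤ c + t • μ := fun l => by
    rcases lt_or_ge (μ l) 0 with hl | hl
    · have := (le_div_iff₀ (neg_pos.2 hl)).1 (hmin l hl)
      simp only [Pi.zero_apply, Pi.add_apply, Pi.smul_apply, smul_eq_mul]
      linarith
    · exact add_nonneg (hc l) (mul_nonneg ht hl)
  have hzero : (c + t • μ) j = 0 := by
    simp only [t, Pi.add_apply, Pi.smul_apply, smul_eq_mul]
    field_simp [hj.ne]
    ring
  have hrep : IsLiftRep a X (c + t • μ) (projLift x) := by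
    simpa using hcx.add (hμ.smul t)
  exact ⟨j, by_contra fun h => hj.ne (hμ.zero_of_notMem j h), hj,
    mem_convexHull_image_iff.2 ⟨_, hnonneg, hrep.erase hzero⟩⟩

lemma exists_mul_neg_mem_convexHull_erase (hx : x ∈ convexHull ℝ (a '' (X : Set (Fin n))))
    (hμ : IsLiftRep a X μ 0) {i : Fin n} (hi : μ i ≠ 0) :
    ∃ j ∈ X, μ i * μ j < 0 ∧ x ∈ convexHull ℝ (a '' (X.erase j : Set (Fin n))) := by
  rcases hi.lt_or_gt with hneg | hpos
  · obtain ⟨j, hj, hμj, hxj⟩ := exists_neg_mem_convexHull_erase hx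
      (by simpa using hμ.smul (-1) : IsLiftRep a X (-μ) 0) (i := i) (neg_pos.2 hneg)
    exact ⟨j, hj, mul_neg_of_neg_of_pos hneg (neg_lt_zero.1 hμj), hxj⟩
  · obtain ⟨j, hj, hμj, hxj⟩ := exists_neg_mem_convexHull_erase hx hμ hpos
    exact ⟨j, hj, mul_neg_of_pos_of_neg hpos hμj, hxj⟩

lemma mul_neg_of_mem_convexHull_erase (hx : x ∉ knotSet a) (hX : X.card = d + 2)
    (hμ : IsLiftRep a X μ 0) {i j : Fin n} (hi : i ∈ X) (hj : j ∈ X) (hij : i ≠ j)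
    (hbasis : IsAffBasis a (X.erase i)) (hμi : μ i ≠ 0)
    (hxi : x ∈ convexHull ℝ (a '' (X.erase i : Set (Fin n))))
    (hxj : x ∈ convexHull ℝ (a '' (X.erase j : Set (Fin n)))) : μ i * μ j < 0 := by
  obtain ⟨c, hc, hcx⟩ := mem_convexHull_image_iff.1 hxi
  obtain ⟨c', hc', hcx'⟩ := mem_convexHull_image_iff.1 hxj
  have hcj : 0 < c j := pos_of_notMem_knotSet hx (by simp [hi, hX]) hc hcx (by simp [hij.symm, hj])
  have hci' : 0 < c' i := pos_of_notMem_knotSet hx (by simp [hj, hX]) hc' hcx' (by simp [hij, hi])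
  have hrel : IsLiftRep a X (c' - c - (c' i / μ i) • μ) 0 := by
    simpa using ((hcx'.mono (X.erase_subset j)).sub (hcx.mono (X.erase_subset i))).sub
      (hμ.smul (c' i / μ i))
  have hzero := congrFun (hbasis.eq_zero (hrel.erase (j := i)
    (by simp [hcx.zero_of_notMem i (X.notMem_erase i), hμi]))) j
  simp only [Pi.sub_apply, Pi.smul_apply, smul_eq_mul, Pi.zero_apply,
    hcx'.zero_of_notMem j (X.notMem_erase j)] at hzero
  field_simp at hzero
  have hprod : c' i * (μ i * μ j) = -(c j * μ i ^ 2) := by linear_combination -μ i * hzero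
  exact (pos_iff_neg_of_mul_neg (hprod ▸ neg_neg_of_pos (by positivity))).1 hci'

lemma detPos_erase_mul_abs (hμ : IsLiftRep a X μ 0) {i j : Fin n} (hi : i ∈ X) (hj : j ∈ X) :
    detPos a (X.erase i) * |μ j| = detPos a (X.erase j) * |μ i| := by
  rcases eq_or_ne i j with rfl | hij
  · rfl
  set C := (X.erase i).erase j with hC
  have hCi : insert j C = X.erase i := Finset.insert_erase (Finset.mem_erase.2 ⟨hij.symm, hj⟩)
  have hCj : insert i C = X.erase j := by
    rw [hC, Finset.erase_right_comm, Finset.insert_erase (Finset.mem_erase.2 ⟨hij, hi⟩)]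
  have hrep : IsLiftRep a (insert j C) (μ - Pi.single i (μ i)) (0 - μ i • projLift (a i)) :=
    hCi ▸ (hμ.sub ((isLiftRep_single a i _).mono (Finset.singleton_subset_iff.2 hi))).erase
      (by simp)
  have hU := hrep.facetFunctional_eq
  simp only [zero_sub, map_neg, map_smul, smul_eq_mul, Pi.sub_apply,
    Pi.single_eq_of_ne hij.symm, sub_zero] at hU
  rw [← hCi, ← hCj, detPos_insert a (Finset.notMem_erase j _),
    detPos_insert a (fun h => X.notMem_erase i (Finset.mem_of_mem_erase h)), mul_comm, ← abs_mul,
    ← hU, abs_neg, mul_comm, abs_mul]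

lemma exists_detPos_erase_eq (hX : X.card = d + 2) (hμ : IsLiftRep a X μ 0) (hμ0 : μ ≠ 0)
    (hspan : ∃ B ⊆ X, IsAffBasis a B) :
    ∃ κ > 0, ∀ i ∈ X, detPos a (X.erase i) = κ * |μ i| := by
  obtain ⟨B, hBX, hB⟩ := hspan
  obtain ⟨j, hjB, rfl⟩ := Finset.exists_eq_insert_iff.2 ⟨hBX, by rw [hB.1, hX]⟩
  have hμj : μ j ≠ 0 := fun h => hμ0 (hB.eq_zero (by simpa [hjB] using hμ.erase h))
  refine ⟨detPos a B / |μ j|, div_pos hB.detPos_pos (abs_pos.2 hμj), fun i hi => ?_⟩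
  have h := detPos_erase_mul_abs hμ hi (Finset.mem_insert_self j B)
  rw [Finset.erase_insert hjB] at h
  rw [div_mul_eq_mul_div, eq_div_iff (abs_pos.2 hμj).ne', h]

end Circuits

section Spline
variable {d n : ℕ} {a : Fin n → Fin d → ℝ} {β : Finset (Fin n) → Finset (Fin n)} {k : ℕ}
  {X : Finset (Fin n)} {x : Fin d → ℝ} {c μ : Fin n → ℝ}

lemma simplexSpline_eq_zero (β : Finset (Fin n) → Finset (Fin n)) (k : ℕ)
    (hX : ¬ ∃ B ⊆ X, IsAffBasis a B) (x : Fin d → ℝ) : simplexSpline a β k X x = 0 := by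
  cases k with
  | zero => rw [simplexSpline, if_neg fun h => hX ⟨X, subset_rfl, h⟩]
  | succ k => rw [simplexSpline, if_neg hX]

lemma simplexSpline_erase_eq_zero (β : Finset (Fin n) → Finset (Fin n)) (k : ℕ)
    (hX : ¬ ∃ B ⊆ X, IsAffBasis a B) (i : Fin n) (x : Fin d → ℝ) :
    simplexSpline a β k (X.erase i) x = 0 :=
  simplexSpline_eq_zero β k (fun ⟨B, hB, h⟩ => hX ⟨B, hB.trans (X.erase_subset i), h⟩) x

lemma simplexSpline_zero_of_mem (β : Finset (Fin n) → Finset (Fin n)) (hX : IsAffBasis a X)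
    (hx : x ∈ convexHull ℝ (a '' (X : Set (Fin n)))) :
    simplexSpline a β 0 X x = d.factorial / detPos a X := by
  rw [simplexSpline, if_pos hX, Set.indicator_of_mem hx, mul_one]

lemma simplexSpline_zero_of_notMem (β : Finset (Fin n) → Finset (Fin n))
    (hx : x ∉ convexHull ℝ (a '' (X : Set (Fin n)))) : simplexSpline a β 0 X x = 0 := by
  rw [simplexSpline, Set.indicator_of_notMem hx, mul_zero, ite_self]

lemma mul_simplexSpline_zero_of_mem (β : Finset (Fin n) → Finset (Fin n)) (hX : IsAffBasis a X)
    (hx : x ∈ convexHull ℝ (a '' (X : Set (Fin n)))) {r κ : ℝ} (hr : detPos a X = κ * |r|) :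
    r * simplexSpline a β 0 X x = d.factorial / κ * Real.sign r := by
  have hr0 : r ≠ 0 := fun h => hX.detPos_pos.ne' (by simp [hr, h])
  have hκ0 : κ ≠ 0 := fun h => hX.detPos_pos.ne' (by simp [hr, h])
  rw [simplexSpline_zero_of_mem β hX hx, hr, ← sign_mul_self_eq_abs]
  have hsign : Real.sign r * Real.sign r = 1 := by
    rcases Real.sign_apply_eq_of_ne_zero _ hr0 with h | h <;> norm_num [h]
  have hs0 : Real.sign r ≠ 0 := left_ne_zero_of_mul_eq_one hsign
  field_simp
  linear_combination -hsign

lemma sum_mul_simplexSpline_erase_zero (β : Finset (Fin n) → Finset (Fin n)) (hx : x ∉ knotSet a)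
    (hX : X.card = d + 2) (hμ : IsLiftRep a X μ 0) :
    ∑ i, μ i * simplexSpline a β 0 (X.erase i) x = 0 := by
  classical
  by_cases hspan : ∃ B ⊆ X, IsAffBasis a B
  swap
  · exact Finset.sum_eq_zero fun i _ => by rw [simplexSpline_erase_eq_zero β 0 hspan, mul_zero]
  rcases eq_or_ne μ 0 with rfl | hμ0
  · simp
  obtain ⟨κ, hκ, hdet⟩ := exists_detPos_erase_eq hX hμ hμ0 hspan
  have hbasis : ∀ i ∈ X, μ i ≠ 0 → IsAffBasis a (X.erase i) := fun i hi h => by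
    rw [← rowDet_ne_zero_iff, ← abs_pos, ← detPos, hdet i hi]
    exact mul_pos hκ (abs_pos.2 h)
  set S := X.filter fun i => μ i ≠ 0 ∧ x ∈ convexHull ℝ (a '' (X.erase i : Set (Fin n)))
  have hterm : ∀ i ∈ S, μ i * simplexSpline a β 0 (X.erase i) x =
      d.factorial / κ * Real.sign (μ i) := fun i hi => by
    obtain ⟨hiX, hμi, hxi⟩ := Finset.mem_filter.1 hi
    exact mul_simplexSpline_zero_of_mem β (hbasis i hiX hμi) hxi (hdet i hiX)
  have hoff : ∀ i ∈ Finset.univ, i ∉ S → μ i * simplexSpline a β 0 (X.erase i) x = 0 :=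
    fun i _ hi => by
      by_cases hμi : μ i = 0
      · rw [hμi, zero_mul]
      have hiX : i ∈ X := by_contra fun h => hμi (hμ.zero_of_notMem i h)
      rw [simplexSpline_zero_of_notMem β fun h => hi (Finset.mem_filter.2 ⟨hiX, hμi, h⟩), mul_zero]
  rw [← Finset.sum_subset (Finset.subset_univ S) hoff, Finset.sum_congr rfl hterm,
    ← Finset.mul_sum, sum_sign_eq_zero, mul_zero]
  · intro i hi j hj hij
    obtain ⟨hiX, hμi, hxi⟩ := Finset.mem_filter.1 hi
    obtain ⟨hjX, -, hxj⟩ := Finset.mem_filter.1 hj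
    exact mul_neg_of_mem_convexHull_erase hx hX hμ hiX hjX hij (hbasis i hiX hμi) hμi hxi hxj
  · intro i hi
    obtain ⟨-, hμi, hxi⟩ := Finset.mem_filter.1 hi
    have hxX := convexHull_mono (Set.image_mono (Finset.coe_subset.2 (X.erase_subset i))) hxi
    obtain ⟨j, hjX, hij, hxj⟩ := exists_mul_neg_mem_convexHull_erase hxX hμ hμi
    exact ⟨j, Finset.mem_filter.2 ⟨hjX, right_ne_zero_of_mul hij.ne, hxj⟩, hij⟩

lemma simplexSpline_succ_of_null (hβ : IsBasisChoice a β)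
    (hnull : ∀ μ, IsLiftRep a X μ 0 → ∑ i, μ i * simplexSpline a β k (X.erase i) x = 0)
    (hc : IsLiftRep a X c (projLift x)) :
    simplexSpline a β (k + 1) X x = (((k + 1 : ℕ) : ℝ) + d) / ((k + 1 : ℕ) : ℝ) *
      ∑ i, c i * simplexSpline a β k (X.erase i) x := by
  by_cases hspan : ∃ B ⊆ X, IsAffBasis a B
  · obtain ⟨hβX, hβB⟩ := hβ X hspan
    obtain ⟨c', hc'⟩ := hβB.exists_isLiftRep (projLift x)
    have hdiff := hnull (c - c') (by simpa using hc.sub (hc'.mono hβX))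
    simp only [Pi.sub_apply, sub_mul, Finset.sum_sub_distrib, sub_eq_zero] at hdiff
    rw [simplexSpline, if_pos hspan, hdiff]
    congr 1
    exact (Finset.sum_congr rfl fun b hb => by rw [hβB.detReplace_div hc' hb]; rfl).trans
      (hc'.sum_eq fun i => simplexSpline a β k (X.erase i) x)
  · simp only [simplexSpline_eq_zero β _ hspan, simplexSpline_erase_eq_zero β _ hspan, mul_zero,
      Finset.sum_const_zero]

lemma mul_simplexSpline_erase_of_null (hβ : IsBasisChoice a β) {i : Fin n}
    (hnull : ∀ ν, IsLiftRep a (X.erase i) ν 0 →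
      ∑ j, ν j * simplexSpline a β k ((X.erase i).erase j) x = 0)
    (hμ : IsLiftRep a X μ 0) (hc : IsLiftRep a X c (projLift x)) :
    μ i * simplexSpline a β (k + 1) (X.erase i) x = (((k + 1 : ℕ) : ℝ) + d) / ((k + 1 : ℕ) : ℝ) *
      ∑ j, (μ i * c j - c i * μ j) * simplexSpline a β k ((X.erase i).erase j) x := by
  rcases eq_or_ne (μ i) 0 with hμi | hμi
  · simp only [hμi, zero_mul, zero_sub, neg_mul, Finset.sum_neg_distrib, mul_assoc,
      ← Finset.mul_sum, hnull μ (hμ.erase hμi), mul_zero, neg_zero]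
  · have hrep : IsLiftRep a (X.erase i) (c - (c i / μ i) • μ) (projLift x) :=
      IsLiftRep.erase (by simpa using hc.sub (hμ.smul (c i / μ i))) (by simp [hμi])
    rw [simplexSpline_succ_of_null hβ hnull hrep, mul_left_comm, Finset.mul_sum]
    congr 1
    refine Finset.sum_congr rfl fun j _ => ?_
    simp only [Pi.sub_apply, Pi.smul_apply, smul_eq_mul]
    field_simp

lemma sum_mul_simplexSpline_erase (hβ : IsBasisChoice a β) (hx : x ∉ knotSet a)
    (hX : X.card = k + d + 2) (hμ : IsLiftRep a X μ 0) :
    ∑ i, μ i * simplexSpline a β k (X.erase i) x = 0 := by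
  induction k generalizing X μ with
  | zero => exact sum_mul_simplexSpline_erase_zero β hx (by omega) hμ
  | succ k ih =>
    by_cases hspan : ∃ B ⊆ X, IsAffBasis a B
    swap
    · simp only [simplexSpline_erase_eq_zero β _ hspan, mul_zero, Finset.sum_const_zero]
    obtain ⟨B, hBX, hB⟩ := hspan
    obtain ⟨c, hcB⟩ := hB.exists_isLiftRep (projLift x)
    have hc := hcB.mono hBX
    have hterm : ∀ i, μ i * simplexSpline a β (k + 1) (X.erase i) x =
        (((k + 1 : ℕ) : ℝ) + d) / ((k + 1 : ℕ) : ℝ) *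
          ∑ j, (μ i * c j - c i * μ j) * simplexSpline a β k ((X.erase i).erase j) x := fun i => by
      by_cases hi : i ∈ X
      · exact mul_simplexSpline_erase_of_null hβ
          (fun ν hν => ih (by rw [Finset.card_erase_of_mem hi, hX]; omega) hν) hμ hc
      · simp [hμ.zero_of_notMem i hi, hc.zero_of_notMem i hi]
    simp only [hterm, ← Finset.mul_sum]
    rw [sum_sum_eq_zero_of_antisymm _ fun i _ j _ => ?_, mul_zero]
    rw [Finset.erase_right_comm]
    ring

theorem simplexSpline_succ_eq (hβ : IsBasisChoice a β) (hx : x ∉ knotSet a)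
    (hX : X.card = k + d + 2) (hc : IsLiftRep a X c (projLift x)) :
    simplexSpline a β (k + 1) X x = (((k + 1 : ℕ) : ℝ) + d) / ((k + 1 : ℕ) : ℝ) *
      ∑ i, c i * simplexSpline a β k (X.erase i) x :=
  simplexSpline_succ_of_null hβ (fun _ hμ => sum_mul_simplexSpline_erase hβ hx hX hμ) hc

end Spline

section Tiles
variable {d n : ℕ} {a : Fin n → Fin d → ℝ} {I B J C : Finset (Fin n)} {c c' : Fin n → ℝ}
  {P : Finset (Finset (Fin n) × Finset (Fin n))} {s t : Finset (Fin n) × Finset (Fin n)}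

/-- The face of the unit cube of `ℝⁿ` that `liftComb a` maps onto `Π_{I,B}`: its points have
coordinates `1` on `I`, in `[0, 1]` on `B`, and `0` elsewhere. -/
def tileCube (I B : Finset (Fin n)) : Set (Fin n → ℝ) :=
  Set.Icc (Set.indicator I 1) (Set.indicator (I ∪ B : Finset (Fin n)) 1)

/-- The relative interior of `tileCube I B`. -/
def openTileCube (I B : Finset (Fin n)) : Set (Fin n → ℝ) :=
  {c ∈ tileCube I B | ∀ b ∈ B, c b ∈ Set.Ioo 0 1}

lemma mem_tileCube_iff : c ∈ tileCube I B ↔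
    (∀ i ∈ I, c i = 1) ∧ (∀ i ∈ B, c i ∈ Set.Icc 0 1) ∧ ∀ i ∉ I, i ∉ B → c i = 0 := by
  simp only [tileCube, Set.mem_Icc, Pi.le_def, Set.indicator_apply, Finset.mem_coe,
    Finset.mem_union, Pi.one_apply]
  refine ⟨fun ⟨hl, hu⟩ => ⟨fun i hi => ?_, fun i hi => ?_, fun i hI hB => ?_⟩,
    fun ⟨h1, h01, h0⟩ => ⟨fun i => ?_, fun i => ?_⟩⟩
  · exact le_antisymm (by simpa [hi] using hu i) (by simpa [hi] using hl i)
  · exact ⟨le_trans (by split_ifs <;> norm_num) (hl i), by simpa [hi] using hu i⟩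
  · exact le_antisymm (by simpa [hI, hB] using hu i) (by simpa [hI] using hl i)
  all_goals
    by_cases hI : i ∈ I
    · simp [hI, h1 i hI]
    by_cases hB : i ∈ B
    · simp [hI, hB, (h01 i hB).1, (h01 i hB).2]
    · simp [hI, hB, h0 i hI hB]

lemma liftComb_of_mem_tileCube (a : Fin n → Fin d → ℝ) (h : Disjoint I B)
    (hc : c ∈ tileCube I B) :
    liftComb a c = ∑ i ∈ I, projLift (a i) + ∑ b ∈ B, c b • projLift (a b) := by
  obtain ⟨h1, -, h0⟩ := mem_tileCube_iff.1 hc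
  rw [liftComb_apply, ← Finset.sum_subset (Finset.subset_univ (I ∪ B)) fun i _ hi => ?_,
    Finset.sum_union h, Finset.sum_congr rfl fun i hi => by rw [h1 i hi, one_smul]]
  rw [Finset.mem_union, not_or] at hi
  rw [h0 i hi.1 hi.2, zero_smul]

lemma tileSet_eq_image (a : Fin n → Fin d → ℝ) (h : Disjoint I B) :
    tileSet a I B = liftComb a '' tileCube I B := by
  ext y
  rw [tileSet, Set.singleton_add, Set.mem_image, Set.mem_image]
  constructor
  · rintro ⟨z, hz, rfl⟩
    obtain ⟨g, hg, rfl⟩ := (Set.mem_finsetSum _ _ _).1 hz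
    have hcoord : ∀ b ∈ B, ∃ t ∈ Set.Icc (0 : ℝ) 1, t • projLift (a b) = g b := fun b hb => by
      simpa [segment_eq_image] using hg hb
    choose! t ht htg using hcoord
    have hB : ∀ b ∈ B, (if b ∈ I then 1 else if b ∈ B then t b else 0) = t b := fun b hb => by
      rw [if_neg (Finset.disjoint_right.1 h hb), if_pos hb]
    have hc : (fun i => if i ∈ I then 1 else if i ∈ B then t i else 0) ∈ tileCube I B :=
      mem_tileCube_iff.2 ⟨fun i hi => if_pos hi, fun i hi => by simpa only [hB i hi] using ht i hi,
        fun i hI hB => by rw [if_neg hI, if_neg hB]⟩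
    refine ⟨_, hc, ?_⟩
    rw [liftComb_of_mem_tileCube a h hc]
    congr 1
    exact Finset.sum_congr rfl fun b hb => by rw [hB b hb, htg b hb]
  · rintro ⟨c, hc, rfl⟩
    refine ⟨_, (Set.mem_finsetSum _ _ _).2 ⟨fun i => c i • projLift (a i), fun {b} hb => ?_, rfl⟩,
      (liftComb_of_mem_tileCube a h hc).symm⟩
    rw [segment_eq_image]
    exact ⟨c b, (mem_tileCube_iff.1 hc).2.1 b hb, by simp⟩

lemma zonotope_eq_tileSet (a : Fin n → Fin d → ℝ) : zonotope a = tileSet a ∅ Finset.univ := by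
  simp [zonotope, tileSet]

lemma liftComb_mem_zonotope (a : Fin n → Fin d → ℝ) (hc : c ∈ tileCube I B) :
    liftComb a c ∈ zonotope a := by
  rw [zonotope_eq_tileSet, tileSet_eq_image a (Finset.disjoint_empty_left _)]
  refine Set.mem_image_of_mem _ (Set.Icc_subset_Icc ?_ ?_ hc)
  · exact Set.indicator_le_indicator_of_subset (by simp) fun _ => zero_le_one
  · exact Set.indicator_le_indicator_of_subset (by simp) fun _ => zero_le_one

lemma isClosed_tileSet (a : Fin n → Fin d → ℝ) (h : Disjoint I B) : IsClosed (tileSet a I B) := by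
  rw [tileSet_eq_image a h]
  exact (isCompact_Icc.image (continuous_liftComb a)).isClosed

lemma isLiftRep_sub (a : Fin n → Fin d → ℝ) (hc : c ∈ tileCube I B) (hc' : c' ∈ tileCube I B) :
    IsLiftRep a B (c - c') (liftComb a c - liftComb a c') := by
  obtain ⟨h1, -, h0⟩ := mem_tileCube_iff.1 hc
  obtain ⟨h1', -, h0'⟩ := mem_tileCube_iff.1 hc'
  refine ⟨fun i hi => ?_, map_sub _ _ _⟩
  by_cases hI : i ∈ I
  · simp [h1 i hI, h1' i hI]
  · simp [h0 i hI hi, h0' i hI hi]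

lemma IsAffBasis.injOn_liftComb (hB : IsAffBasis a B) :
    Set.InjOn (liftComb a) (tileCube I B) := fun _ hc _ hc' h =>
  sub_eq_zero.1 (hB.eq_zero (sub_eq_zero.2 h ▸ isLiftRep_sub a hc hc'))

namespace IsTileFace

lemma tileCube_subset (h : IsTileFace J C I B) : tileCube J C ⊆ tileCube I B := by
  have hIJ : (I : Set (Fin n)) ⊆ J := mod_cast h.2.1
  have hJC : ((J ∪ C : Finset (Fin n)) : Set (Fin n)) ⊆ (I ∪ B : Finset (Fin n)) :=
    mod_cast Finset.union_subset h.2.2.1 (h.1.trans Finset.subset_union_right)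
  exact Set.Icc_subset_Icc (Set.indicator_le_indicator_of_subset hIJ fun _ => zero_le_one)
    (Set.indicator_le_indicator_of_subset hJC fun _ => zero_le_one)

lemma eq_of_card (h : IsTileFace J C I B) (hcard : B.card ≤ C.card) : J = I ∧ C = B := by
  obtain rfl : C = B := Finset.eq_of_subset_of_card_le h.1 hcard
  refine ⟨Finset.Subset.antisymm (fun i hi => ?_) h.2.1, rfl⟩
  exact (Finset.mem_union.1 (h.2.2.1 hi)).resolve_right (Finset.disjoint_left.1 h.2.2.2 hi)

lemma exists_eq_erase_insert (h : IsTileFace J C I B) (hIB : Disjoint I B)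
    (hcard : B.card = C.card + 1) : ∃ b ∉ C, I = J.erase b ∧ B = insert b C := by
  obtain ⟨hCB, hIJ, hJ, hJC⟩ := h
  obtain ⟨b, hbC, hB⟩ := Finset.exists_eq_insert_iff.2 ⟨hCB, hcard.symm⟩
  subst hB
  refine ⟨b, hbC, ?_, rfl⟩
  simp only [Finset.disjoint_left, Finset.subset_iff] at hIB hIJ hJ hJC
  ext i
  grind

end IsTileFace

lemma eq_of_mem_tileCube (hI : Disjoint I B) (hJ : Disjoint J B) (hc : c ∈ tileCube I B)
    (hc' : c ∈ tileCube J B) : I = J := by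
  obtain ⟨h1, -, h0⟩ := mem_tileCube_iff.1 hc
  obtain ⟨h1', -, h0'⟩ := mem_tileCube_iff.1 hc'
  ext i
  refine ⟨fun hi => ?_, fun hi => ?_⟩ <;> by_contra hi'
  · exact one_ne_zero ((h1 i hi).symm.trans (h0' i hi' (Finset.disjoint_left.1 hI hi)))
  · exact one_ne_zero ((h1' i hi).symm.trans (h0 i hi' (Finset.disjoint_left.1 hJ hi)))

lemma subset_of_mem_openTileCube (hc : c ∈ openTileCube I B) (hc' : c ∈ tileCube J C) :
    B ⊆ C := fun b hb => by
  obtain ⟨h1, -, h0⟩ := mem_tileCube_iff.1 hc'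
  have hIoo := hc.2 b hb
  by_contra hbC
  by_cases hbJ : b ∈ J
  · exact hIoo.2.ne (h1 b hbJ)
  · exact hIoo.1.ne' (h0 b hbJ hbC)

namespace IsFineZonotopalTiling

lemma tileSet_eq_image (hP : IsFineZonotopalTiling a P) (ht : t ∈ P) :
    tileSet a t.1 t.2 = liftComb a '' tileCube t.1 t.2 :=
  _root_.tileSet_eq_image a (hP.tile t ht).1

lemma exists_mem_tileSet (hP : IsFineZonotopalTiling a P) {y : Fin (d + 1) → ℝ}
    (hy : y ∈ zonotope a) : ∃ t ∈ P, y ∈ tileSet a t.1 t.2 := by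
  simpa [← hP.cover] using hy

lemma exists_common_face (hP : IsFineZonotopalTiling a P) (hs : s ∈ P) (ht : t ∈ P)
    (hc : c ∈ tileCube t.1 t.2) (hcs : liftComb a c ∈ tileSet a s.1 s.2) :
    ∃ J C, IsTileFace J C s.1 s.2 ∧ IsTileFace J C t.1 t.2 ∧ c ∈ tileCube J C := by
  have hct : liftComb a c ∈ tileSet a t.1 t.2 := hP.tileSet_eq_image ht ▸ ⟨c, hc, rfl⟩
  obtain ⟨J, C, hfs, hft, hJC⟩ := hP.inter s hs t ht ⟨_, hcs, hct⟩
  obtain ⟨c', hc', heq⟩ : liftComb a c ∈ liftComb a '' tileCube J C :=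
    _root_.tileSet_eq_image a hfs.2.2.2 ▸ hJC ▸ ⟨hcs, hct⟩
  exact ⟨J, C, hfs, hft,
    (hP.tile t ht).2.injOn_liftComb (hft.tileCube_subset hc') hc heq ▸ hc'⟩

lemma eq_of_mem_openTileCube (hP : IsFineZonotopalTiling a P) (hs : s ∈ P) (ht : t ∈ P)
    (hc : c ∈ openTileCube t.1 t.2) (hcs : liftComb a c ∈ tileSet a s.1 s.2) : s = t := by
  obtain ⟨J, C, hfs, hft, hcJC⟩ := hP.exists_common_face hs ht hc.1 hcs
  have hcard := Finset.card_le_card (subset_of_mem_openTileCube hc hcJC)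
  obtain ⟨ht1, ht2⟩ := hft.eq_of_card hcard
  obtain ⟨hs1, hs2⟩ := hfs.eq_of_card (by rwa [(hP.tile s hs).2.1, ← (hP.tile t ht).2.1])
  exact Prod.ext (hs1.symm.trans ht1) (hs2.symm.trans ht2)

end IsFineZonotopalTiling

end Tiles

section Facets
open Filter Topology

variable {d n : ℕ} {a : Fin n → Fin d → ℝ} {J C : Finset (Fin n)} {b b' : Fin n}
  {c e : Fin n → ℝ} {w y : Fin (d + 1) → ℝ} {P : Finset (Finset (Fin n) × Finset (Fin n))}
  {t : Finset (Fin n) × Finset (Fin n)}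

/-- Coordinates of the centre of the face `Π_{J,C}`. -/
noncomputable def faceCenter (J C : Finset (Fin n)) (i : Fin n) : ℝ :=
  if i ∈ C then 1 / 2 else if i ∈ J then 1 else 0

/-- The sign `s` for which `s • v_b` points from the facet `Π_{J,C}` into the tile with generators
`insert b C` adjacent to it. -/
def inwardSign (J : Finset (Fin n)) (b : Fin n) : ℝ := if b ∈ J then -1 else 1

/-- A number whose sign tells on which side of the hyperplane spanned by `(v_i)_{i ∈ C}` the tile
`Π_{J \ b, C ∪ b}` lies. -/
noncomputable def facetSide (a : Fin n → Fin d → ℝ) (J C : Finset (Fin n)) (b : Fin n) : ℝ :=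
  inwardSign J b * facetFunctional a C (projLift (a b))

/-- The generators `b` for which `Π_{J \ b, C ∪ b}`, of which `Π_{J,C}` is a facet, is a tile. -/
def adjacentGenerators (P : Finset (Finset (Fin n) × Finset (Fin n))) (J C : Finset (Fin n)) :
    Finset (Fin n) :=
  {b | b ∉ C ∧ (J.erase b, insert b C) ∈ P}

lemma mem_adjacentGenerators :
    b ∈ adjacentGenerators P J C ↔ b ∉ C ∧ (J.erase b, insert b C) ∈ P := by
  simp [adjacentGenerators]

lemma inwardSign_mul_single_pos (J : Finset (Fin n)) (b : Fin n) :
    0 < inwardSign J b * (Pi.single b (inwardSign J b) : Fin n → ℝ) b := by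
  rw [Pi.single_eq_same, inwardSign]
  split_ifs <;> norm_num

lemma isLiftRep_inwardSign (a : Fin n → Fin d → ℝ) (J C : Finset (Fin n)) (b : Fin n) :
    IsLiftRep a (insert b C) (Pi.single b (inwardSign J b)) (inwardSign J b • projLift (a b)) :=
  (isLiftRep_single a b _).mono (by simp)

lemma isTileFace_erase_insert (h : Disjoint J C) (b : Fin n) :
    IsTileFace J C (J.erase b) (insert b C) :=
  ⟨Finset.subset_insert b C, Finset.erase_subset b J, fun i hi => by grind, h⟩

lemma faceCenter_mem_openTileCube (h : Disjoint J C) : faceCenter J C ∈ openTileCube J C := by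
  have hC : ∀ i ∈ C, faceCenter J C i ∈ Set.Ioo 0 1 := fun i hi => by
    rw [faceCenter, if_pos hi]; norm_num
  refine ⟨mem_tileCube_iff.2 ⟨fun i hi => ?_, fun i hi => Set.Ioo_subset_Icc_self (hC i hi),
    fun i hJ hC => ?_⟩, hC⟩
  · rw [faceCenter, if_neg (Finset.disjoint_left.1 h hi), if_pos hi]
  · rw [faceCenter, if_neg hC, if_neg hJ]

lemma faceCenter_mem_tileCube (h : Disjoint J C) (b : Fin n) :
    faceCenter J C ∈ tileCube (J.erase b) (insert b C) :=
  (isTileFace_erase_insert h b).tileCube_subset (faceCenter_mem_openTileCube h).1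

lemma eventually_mem_openTileCube (h : Disjoint J C) (hb : b ∉ C)
    (he : ∀ i ∉ insert b C, e i = 0) (hinward : 0 < inwardSign J b * e b) :
    ∀ᶠ δ in 𝓝[>] (0 : ℝ),
      faceCenter J C + δ • e ∈ openTileCube (J.erase b) (insert b C) := by
  obtain ⟨h1, -, h0⟩ := mem_tileCube_iff.1 (faceCenter_mem_tileCube h b)
  have hlim (i : Fin n) : Tendsto (fun δ : ℝ => faceCenter J C i + δ * e i) (𝓝[>] 0)
      (𝓝 (faceCenter J C i)) :=
    tendsto_nhdsWithin_of_tendsto_nhds (Continuous.tendsto' (by fun_prop) _ _ (by simp))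
  have hC : ∀ i ∈ C, ∀ᶠ δ in 𝓝[>] (0 : ℝ), faceCenter J C i + δ * e i ∈ Set.Ioo 0 1 :=
    fun i hi => (hlim i).eventually
      (isOpen_Ioo.mem_nhds ((faceCenter_mem_openTileCube h).2 i hi))
  have hbIoo : ∀ᶠ δ in 𝓝[>] (0 : ℝ), faceCenter J C b + δ * e b ∈ Set.Ioo 0 1 := by
    by_cases hbJ : b ∈ J
    · have hval : faceCenter J C b = 1 := by rw [faceCenter, if_neg hb, if_pos hbJ]
      rw [inwardSign, if_pos hbJ] at hinward
      filter_upwards [self_mem_nhdsWithin, (hlim b).eventually_const_lt (hval ▸ one_pos)]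
        with δ hδ hpos
      exact ⟨hpos, by rw [hval]; nlinarith [Set.mem_Ioi.1 hδ]⟩
    · have hval : faceCenter J C b = 0 := by rw [faceCenter, if_neg hb, if_neg hbJ]
      rw [inwardSign, if_neg hbJ] at hinward
      filter_upwards [self_mem_nhdsWithin, (hlim b).eventually_lt_const (hval ▸ one_pos)]
        with δ hδ hlt
      exact ⟨by rw [hval]; nlinarith [Set.mem_Ioi.1 hδ], hlt⟩
  filter_upwards [(eventually_all_finset C).2 hC, hbIoo] with δ hδC hδb
  have hIoo : ∀ i ∈ insert b C, (faceCenter J C + δ • e) i ∈ Set.Ioo 0 1 :=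
    Finset.forall_mem_insert _ _ _ |>.2 ⟨hδb, hδC⟩
  refine ⟨mem_tileCube_iff.2 ⟨fun i hi => ?_, fun i hi => Set.Ioo_subset_Icc_self (hIoo i hi),
    fun i hJ hC => by simp [h0 i hJ hC, he i hC]⟩, hIoo⟩
  have hiC : i ∉ insert b C := fun hiC => (Finset.mem_insert.1 hiC).elim
    (Finset.ne_of_mem_erase hi) (Finset.disjoint_left.1 h (Finset.mem_of_mem_erase hi))
  simp [h1 i hi, he i hiC]

lemma facetFunctional_sub_mul_facetSide_nonneg (a : Fin n → Fin d → ℝ) (h : Disjoint J C)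
    (hb : b ∉ C) (hc : c ∈ tileCube (J.erase b) (insert b C)) :
    0 ≤ facetFunctional a C (liftComb a c - liftComb a (faceCenter J C)) * facetSide a J C b := by
  have hinward : 0 ≤ (c b - faceCenter J C b) * inwardSign J b := by
    have hcb := (mem_tileCube_iff.1 hc).2.1 b (Finset.mem_insert_self b C)
    rw [faceCenter, if_neg hb, inwardSign]
    split_ifs <;> linarith [hcb.1, hcb.2]
  rw [(isLiftRep_sub a hc (faceCenter_mem_tileCube h b)).facetFunctional_eq, facetSide,
    Pi.sub_apply, mul_mul_mul_comm]
  exact mul_nonneg hinward (mul_self_nonneg _)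

namespace IsFineZonotopalTiling

lemma disjoint_of_mem_adjacentGenerators (hP : IsFineZonotopalTiling a P)
    (hb : b ∈ adjacentGenerators P J C) : Disjoint J C := by
  obtain ⟨hbC, hbP⟩ := mem_adjacentGenerators.1 hb
  have hdisj := (hP.tile _ hbP).1
  rw [Finset.disjoint_left] at hdisj ⊢
  exact fun i hi hiC => hdisj (Finset.mem_erase.2 ⟨fun h => hbC (h ▸ hiC), hi⟩)
    (Finset.mem_insert_of_mem hiC)

lemma facetSide_ne_zero (hP : IsFineZonotopalTiling a P) (hb : b ∈ adjacentGenerators P J C) :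
    facetSide a J C b ≠ 0 := by
  obtain ⟨hbC, hbP⟩ := mem_adjacentGenerators.1 hb
  refine mul_ne_zero ?_ ((facetFunctional_ne_zero_iff hbC).2 (hP.tile _ hbP).2)
  rw [inwardSign]
  split_ifs <;> norm_num

lemma facetSide_mul_neg (hP : IsFineZonotopalTiling a P) (hb : b ∈ adjacentGenerators P J C)
    (hb' : b' ∈ adjacentGenerators P J C) (hne : b ≠ b') :
    facetSide a J C b * facetSide a J C b' < 0 := by
  have hJC := hP.disjoint_of_mem_adjacentGenerators hb
  refine (mul_ne_zero (hP.facetSide_ne_zero hb) (hP.facetSide_ne_zero hb')).lt_of_le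
    (not_lt.1 fun hpos => hne ?_)
  obtain ⟨hbC, hbP⟩ := mem_adjacentGenerators.1 hb
  obtain ⟨hbC', hbP'⟩ := mem_adjacentGenerators.1 hb'
  obtain ⟨e, he⟩ := (hP.tile _ hbP).2.exists_isLiftRep (inwardSign J b' • projLift (a b'))
  have heb : 0 < inwardSign J b * e b := by
    have hU : facetSide a J C b' = e b * facetFunctional a C (projLift (a b)) := by
      rw [← he.facetFunctional_eq, map_smul, smul_eq_mul, facetSide]
    rw [hU, facetSide, mul_mul_mul_comm] at hpos
    exact pos_of_mul_pos_left hpos (mul_self_nonneg _)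
  have he' := isLiftRep_inwardSign a J C b'
  obtain ⟨δ, hδ, hδ'⟩ := ((eventually_mem_openTileCube hJC hbC he.zero_of_notMem heb).and
    (eventually_mem_openTileCube hJC hbC' he'.zero_of_notMem
      (inwardSign_mul_single_pos J b'))).exists
  have hcomb : liftComb a (faceCenter J C + δ • Pi.single b' (inwardSign J b')) =
      liftComb a (faceCenter J C + δ • e) := by
    rw [map_add, map_add, map_smul, map_smul, he.map_eq, he'.map_eq]
  have heq := hP.eq_of_mem_openTileCube hbP hbP' hδ'
    (hcomb ▸ hP.tileSet_eq_image hbP ▸ Set.mem_image_of_mem _ hδ.1)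
  exact (Finset.insert_inj hbC).1 (Prod.ext_iff.1 heq).2

lemma exists_mem_tileSet_add_smul (hP : IsFineZonotopalTiling a P)
    (h : ∀ᶠ ε in 𝓝[>] (0 : ℝ), y + ε • w ∈ zonotope a) :
    ∃ t ∈ P, y ∈ tileSet a t.1 t.2 ∧ ∃ ε > (0 : ℝ), y + ε • w ∈ tileSet a t.1 t.2 := by
  obtain ⟨t, ht, hfreq⟩ : ∃ t ∈ P, ∃ᶠ ε in 𝓝[>] (0 : ℝ), y + ε • w ∈ tileSet a t.1 t.2 := by
    by_contra! hnot
    obtain ⟨ε, hε, hεZ⟩ := (((eventually_all_finset P).2 hnot).and h).exists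
    obtain ⟨t, ht, hεt⟩ := hP.exists_mem_tileSet hεZ
    exact hε t ht hεt
  have hlim : Tendsto (fun ε : ℝ => y + ε • w) (𝓝[>] 0) (𝓝 y) :=
    tendsto_nhdsWithin_of_tendsto_nhds (Continuous.tendsto' (by fun_prop) _ _ (by simp))
  obtain ⟨ε, hεt, hε⟩ := (hfreq.and_eventually self_mem_nhdsWithin).exists
  exact ⟨t, ht, (isClosed_tileSet a (hP.tile t ht).1).mem_of_frequently_of_tendsto hfreq hlim,
    ε, hε, hεt⟩

lemma exists_eq_of_faceCenter_mem (hP : IsFineZonotopalTiling a P)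
    (hb : b ∈ adjacentGenerators P J C) (ht : t ∈ P)
    (hmem : liftComb a (faceCenter J C) ∈ tileSet a t.1 t.2) :
    ∃ b' ∈ adjacentGenerators P J C, t = (J.erase b', insert b' C) := by
  have hJC := hP.disjoint_of_mem_adjacentGenerators hb
  obtain ⟨hbC, hbP⟩ := mem_adjacentGenerators.1 hb
  obtain ⟨J', C', hface, hface', hcenter⟩ :=
    hP.exists_common_face ht hbP (faceCenter_mem_tileCube hJC b) hmem
  have hsub : C ⊆ C' := subset_of_mem_openTileCube (faceCenter_mem_openTileCube hJC) hcenter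
  have hcard : t.2.card = (insert b C).card := (hP.tile t ht).2.1.trans (hP.tile _ hbP).2.1.symm
  by_cases hbC' : b ∈ C'
  · have hle : (insert b C).card ≤ C'.card := Finset.card_le_card (Finset.insert_subset hbC' hsub)
    obtain ⟨h1, h2⟩ := hface.eq_of_card (hcard.trans_le hle)
    obtain ⟨h1', h2'⟩ := hface'.eq_of_card hle
    exact ⟨b, hb, Prod.ext (h1.symm.trans h1') (h2.symm.trans h2')⟩
  · obtain rfl : C' = C := Finset.Subset.antisymm
      (((Finset.subset_insert_iff_of_notMem hbC').1 hface'.1)) hsub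
    obtain rfl : J' = J := eq_of_mem_tileCube hface.2.2.2 hJC hcenter
      (faceCenter_mem_openTileCube hJC).1
    obtain ⟨b', hb'C, h1, h2⟩ := hface.exists_eq_erase_insert (hP.tile t ht).1
      (hcard.trans (Finset.card_insert_of_notMem hbC))
    exact ⟨b', mem_adjacentGenerators.2 ⟨hb'C, h1 ▸ h2 ▸ ht⟩, Prod.ext h1 h2⟩

lemma exists_facetSide_mul_neg (hP : IsFineZonotopalTiling a P)
    (hb : b ∈ adjacentGenerators P J C) (hw : facetFunctional a C w * facetSide a J C b < 0)
    (hZ : ∀ᶠ ε in 𝓝[>] (0 : ℝ), liftComb a (faceCenter J C) + ε • w ∈ zonotope a) :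
    ∃ b' ∈ adjacentGenerators P J C, facetSide a J C b * facetSide a J C b' < 0 := by
  obtain ⟨t, ht, hcenter, ε, hε, hmem⟩ := hP.exists_mem_tileSet_add_smul hZ
  obtain ⟨b', hb', rfl⟩ := hP.exists_eq_of_faceCenter_mem hb ht hcenter
  obtain ⟨c, hc, hcw⟩ := hP.tileSet_eq_image ht ▸ hmem
  have hside := facetFunctional_sub_mul_facetSide_nonneg a
    (hP.disjoint_of_mem_adjacentGenerators hb) (mem_adjacentGenerators.1 hb').1 hc
  rw [hcw, add_sub_cancel_left, map_smul, smul_eq_mul, mul_assoc] at hside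
  have hw' : 0 ≤ facetFunctional a C w * facetSide a J C b' := nonneg_of_mul_nonneg_right hside hε
  refine ⟨b', hb', (mul_ne_zero (hP.facetSide_ne_zero hb) (hP.facetSide_ne_zero hb')).lt_of_le
    (not_lt.1 fun hpos => ?_)⟩
  have hU := mul_pos (mul_self_pos.2 (left_ne_zero_of_mul hw.ne)) hpos
  linarith [mul_nonpos_of_nonpos_of_nonneg hw.le hw', mul_mul_mul_comm (facetFunctional a C w)
    (facetFunctional a C w) (facetSide a J C b) (facetSide a J C b')]

end IsFineZonotopalTiling

end Facets

section Cancellation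
open Filter Topology

variable {d n m : ℕ} {a : Fin n → Fin d → ℝ} {J C : Finset (Fin n)} {i : Fin n}
  {P : Finset (Finset (Fin n) × Finset (Fin n))}

/-- Every vertex of `ch(A)` occurs at least `m` times in the configuration `A`. -/
def VerticesRepeated (a : Fin n → Fin d → ℝ) (m : ℕ) : Prop :=
  ∀ p ∈ (hull a).extremePoints ℝ, m ≤ (Finset.univ.filter fun i : Fin n => a i = p).card

lemma exists_extremePoint_pos (L : (Fin (d + 1) → ℝ) →ₗ[ℝ] ℝ) (hi : 0 < L (projLift (a i))) :
    ∃ p ∈ (hull a).extremePoints ℝ, 0 < L (projLift p) := by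
  by_contra! h
  have hcpt : IsCompact (hull a) := (Set.finite_range a).isCompact_convexHull ℝ
  have hcont : Continuous fun p => L (projLift p) :=
    (LinearMap.continuous_of_finiteDimensional L).comp continuous_projLift
  have hclosed : IsClosed {p | L (projLift p) ≤ 0} := isClosed_le hcont continuous_const
  have hconv : Convex ℝ {p | L (projLift p) ≤ 0} := by
    intro p hp q hq s t hs ht hst
    simp only [Set.mem_ofPred] at hp hq ⊢
    rw [projLift_smul_add_smul hst, map_add, map_smul, map_smul, smul_eq_mul, smul_eq_mul]
    exact add_nonpos (mul_nonpos_of_nonneg_of_nonpos hs hp) (mul_nonpos_of_nonneg_of_nonpos ht hq)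
  have hsub : hull a ⊆ {p | L (projLift p) ≤ 0} := by
    rw [← closure_convexHull_extremePoints hcpt (convex_convexHull ℝ _)]
    exact closure_minimal (convexHull_min h hconv) hclosed
  exact (hsub (subset_convexHull ℝ _ ⟨i, rfl⟩)).not_gt hi

lemma VerticesRepeated.exists_inwardSign_mul_pos (h : VerticesRepeated a m) (hJ : J.card < m)
    (L : (Fin (d + 1) → ℝ) →ₗ[ℝ] ℝ) (hi : i ∈ J) (hL : L (projLift (a i)) ≠ 0) :
    ∃ j, 0 < inwardSign J j * L (projLift (a j)) := by
  rcases hL.lt_or_gt with hneg | hpos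
  · exact ⟨i, by rw [inwardSign, if_pos hi]; linarith⟩
  · obtain ⟨p, hp, hLp⟩ := exists_extremePoint_pos L hpos
    obtain ⟨j, hj, hjJ⟩ := Finset.exists_mem_notMem_of_card_lt_card (hJ.trans_le (h p hp))
    obtain rfl := (Finset.mem_filter.1 hj).2
    exact ⟨j, by rwa [inwardSign, if_neg hjJ, one_mul]⟩

lemma eventually_add_smul_mem_zonotope (a : Fin n → Fin d → ℝ) (hJC : Disjoint J C)
    (hi : i ∉ C) :
    ∀ᶠ ε in 𝓝[>] (0 : ℝ),
      liftComb a (faceCenter J C) + ε • (inwardSign J i • projLift (a i)) ∈ zonotope a := by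
  filter_upwards [eventually_mem_openTileCube hJC hi (isLiftRep_inwardSign a J C i).zero_of_notMem
    (inwardSign_mul_single_pos J i)] with ε hε
  rw [← (isLiftRep_inwardSign a J C i).map_eq, ← map_smul, ← map_add]
  exact liftComb_mem_zonotope a hε.1

lemma IsFineZonotopalTiling.sum_sign_facetSide_eq_zero (hP : IsFineZonotopalTiling a P)
    (hrep : VerticesRepeated a m) (hJ : J.card < m) (hX : ∃ B ⊆ J ∪ C, IsAffBasis a B) :
    ∑ b ∈ adjacentGenerators P J C, Real.sign (facetSide a J C b) = 0 := by
  refine sum_sign_eq_zero (fun b hb b' hb' hne => hP.facetSide_mul_neg hb hb' hne) fun b hb => ?_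
  have hside := hP.facetSide_ne_zero hb
  obtain ⟨B, hBX, hB⟩ := hX
  set L := -facetSide a J C b • facetFunctional a C with hL
  have hLC : ∀ j ∈ C, L (projLift (a j)) = 0 := fun j hj => by
    rw [hL, LinearMap.smul_apply, facetFunctional_of_mem a hj, smul_zero]
  have hL0 : L ≠ 0 :=
    smul_ne_zero (neg_ne_zero.2 hside) fun h0 => hside (by simp [facetSide, h0])
  obtain ⟨i, hiB, hLi⟩ := hB.exists_map_projLift_ne_zero hL0
  have hiJ : i ∈ J := (Finset.mem_union.1 (hBX hiB)).resolve_right fun hiC => hLi (hLC i hiC)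
  obtain ⟨j, hj⟩ := hrep.exists_inwardSign_mul_pos hJ L hiJ hLi
  have hjC : j ∉ C := fun hjC => by simp [hLC j hjC] at hj
  refine hP.exists_facetSide_mul_neg hb ?_
    (eventually_add_smul_mem_zonotope a (hP.disjoint_of_mem_adjacentGenerators hb) hjC)
  rw [hL, LinearMap.smul_apply, smul_eq_mul] at hj
  rw [map_smul, smul_eq_mul]
  linarith

end Cancellation

section Exchange
variable {d n k : ℕ} {a : Fin n → Fin d → ℝ} {P : Finset (Finset (Fin n) × Finset (Fin n))}

lemma IsFineZonotopalTiling.sum_adjacentGenerators (hP : IsFineZonotopalTiling a P)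
    (F : Finset (Fin n) → Finset (Fin n) → Fin n → ℝ) :
    ∑ f : Finset (Fin n) × Finset (Fin n), ∑ b ∈ adjacentGenerators P f.1 f.2, F f.1 f.2 b =
      ∑ t ∈ P, ∑ b ∈ t.2, (F t.1 (t.2.erase b) b + F (insert b t.1) (t.2.erase b) b) := by
  rw [Finset.sum_sigma', Finset.sum_sigma', ← Finset.sum_fiberwise_of_maps_to
    (t := P.sigma fun t => t.2) (g := fun s => ⟨(s.1.1.erase s.2, insert s.2 s.1.2), s.2⟩)
    fun s hs => ?_]
  · refine Finset.sum_congr rfl fun ⟨⟨I, B⟩, b⟩ hb => ?_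
    obtain ⟨ht, hbB : b ∈ B⟩ := Finset.mem_sigma.1 hb
    have hbI : b ∉ I := Finset.disjoint_right.1 (hP.tile _ ht).1 hbB
    rw [← Finset.sum_pair (f := fun s : (_ : Finset (Fin n) × Finset (Fin n)) × Fin n =>
      F s.1.1 s.1.2 s.2) (a := ⟨(I, B.erase b), b⟩) (b := ⟨(insert b I, B.erase b), b⟩)]
    · refine Finset.sum_congr ?_ fun _ _ => rfl
      ext ⟨⟨J, C⟩, b'⟩
      simp only [Finset.mem_filter, Finset.mem_sigma, Finset.mem_univ, mem_adjacentGenerators,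
        true_and, Sigma.mk.injEq, Prod.mk.injEq, heq_eq_eq, Finset.mem_insert, Finset.mem_singleton]
      constructor
      · rintro ⟨⟨hC, -⟩, ⟨rfl, rfl⟩, rfl⟩
        rw [Finset.erase_insert hC]
        by_cases hJ : b' ∈ J <;> simp [hJ]
      · rintro (⟨⟨rfl, rfl⟩, rfl⟩ | ⟨⟨rfl, rfl⟩, rfl⟩) <;>
          simpa [Finset.insert_erase hbB, hbI] using ht
    · simpa using fun h : I = insert b I => hbI (h ▸ Finset.mem_insert_self b I)
  · obtain ⟨-, hbP⟩ := mem_adjacentGenerators.1 (Finset.mem_sigma.1 hs).2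
    exact Finset.mem_sigma.2 ⟨hbP, Finset.mem_insert_self _ _⟩

theorem IsFineZonotopalTiling.sum_mul_detReplace_exchange (hP : IsFineZonotopalTiling a P)
    (hrep : VerticesRepeated a (k + 2)) {H : Finset (Fin n) → Finset (Fin n) → ℝ}
    (hH : ∀ J C, (¬ ∃ B ⊆ J ∪ C, IsAffBasis a B) → H J C = 0) (x : Fin d → ℝ) :
    ∑ t ∈ P with t.1.card = k + 1, ∑ b ∈ t.2, H t.1 (t.2.erase b) * detReplace a t.2 b x =
      ∑ t ∈ P with t.1.card = k, ∑ b ∈ t.2,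
        H (insert b t.1) (t.2.erase b) * detReplace a t.2 b x := by
  set F : Finset (Fin n) → Finset (Fin n) → Fin n → ℝ := fun J C b =>
    if J.card = k + 1 then
      H J C * facetFunctional a C (projLift x) * Real.sign (facetSide a J C b)
    else 0 with hF
  have hsum : ∀ J C, ∑ b ∈ adjacentGenerators P J C, F J C b = 0 := fun J C => by
    by_cases hX : J.card = k + 1 ∧ ∃ B ⊆ J ∪ C, IsAffBasis a B
    · simp only [hF, if_pos hX.1, ← Finset.mul_sum,
        hP.sum_sign_facetSide_eq_zero hrep (hX.1.trans_lt (by omega)) hX.2, mul_zero]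
    · refine Finset.sum_eq_zero fun b _ => ?_
      simp only [hF, ite_eq_right_iff]
      intro hJ
      rw [hH J C fun hB => hX ⟨hJ, hB⟩, zero_mul, zero_mul]
  have hflags := hP.sum_adjacentGenerators F
  simp only [hsum, Finset.sum_const_zero] at hflags
  rw [← sub_eq_zero, hflags, Finset.sum_filter, Finset.sum_filter, ← Finset.sum_sub_distrib]
  refine Finset.sum_congr rfl fun t ht => ?_
  have hterm : ∀ b ∈ t.2,
      F t.1 (t.2.erase b) b + F (insert b t.1) (t.2.erase b) b =
        (if t.1.card = k + 1 then H t.1 (t.2.erase b) * detReplace a t.2 b x else 0) -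
          if t.1.card = k then H (insert b t.1) (t.2.erase b) * detReplace a t.2 b x
          else 0 := fun b hb => by
    have hbI : b ∉ t.1 := Finset.disjoint_right.1 (hP.tile t ht).1 hb
    have hdet := detReplace_insert a (Finset.notMem_erase b t.2) x
    rw [Finset.insert_erase hb] at hdet
    simp only [hF, facetSide, inwardSign, Finset.mem_insert_self, if_pos, if_neg hbI,
      Finset.card_insert_of_notMem hbI, Nat.add_right_cancel_iff, hdet, one_mul, neg_mul,
      Real.sign_neg]
    split_ifs <;> ring
  rw [Finset.sum_congr rfl hterm, Finset.sum_sub_distrib]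
  split_ifs <;> simp

end Exchange

section PolarForms
variable {d n k : ℕ}

/-- `Q` is a symmetric function of its `k` arguments. -/
def IsPermInvariant (Q : (Fin k → Fin d → ℝ) → ℝ) : Prop :=
  ∀ (σ : Equiv.Perm (Fin k)) (p : Fin k → Fin d → ℝ), Q (p ∘ σ) = Q p

/-- `Q` is affine in each of its `k` arguments. -/
def IsMultiaffine (Q : (Fin k → Fin d → ℝ) → ℝ) : Prop :=
  ∀ (p : Fin k → Fin d → ℝ) (j : Fin k) (y z : Fin d → ℝ) (s : ℝ),
    Q (Function.update p j ((1 - s) • y + s • z)) =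
      (1 - s) * Q (Function.update p j y) + s * Q (Function.update p j z)

/-- The function `Q(x, ·)` of the remaining `k` arguments. -/
def fixFirst (Q : (Fin (k + 1) → Fin d → ℝ) → ℝ) (x : Fin d → ℝ) : (Fin k → Fin d → ℝ) → ℝ :=
  fun p => Q (Fin.cons (α := fun _ => Fin d → ℝ) x p)

lemma fixFirst_diag (Q : (Fin (k + 1) → Fin d → ℝ) → ℝ) (x : Fin d → ℝ) :
    fixFirst Q x (fun _ => x) = Q fun _ => x := by
  rw [fixFirst]
  congr 1
  ext j : 1
  cases j using Fin.cases <;> rfl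

lemma IsPermInvariant.fixFirst {Q : (Fin (k + 1) → Fin d → ℝ) → ℝ} (hQ : IsPermInvariant Q)
    (x : Fin d → ℝ) : IsPermInvariant (fixFirst Q x) := fun σ p => by
  rw [_root_.fixFirst, _root_.fixFirst, ← hQ (Equiv.Perm.decomposeFin.symm (0, σ)) (Fin.cons x p)]
  congr 1
  ext j : 1
  cases j using Fin.cases <;> simp

lemma IsMultiaffine.fixFirst {Q : (Fin (k + 1) → Fin d → ℝ) → ℝ} (hQ : IsMultiaffine Q)
    (x : Fin d → ℝ) : IsMultiaffine (fixFirst Q x) := fun p j y z s => by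
  simp only [_root_.fixFirst, Fin.cons_update]
  exact hQ _ _ _ _ _

section PolarAt
variable {a : Fin n → Fin d → ℝ} {I B : Finset (Fin n)} {b : Fin n}

lemma polarAt_eq {Q : (Fin k → Fin d → ℝ) → ℝ} (hQ : IsPermInvariant Q) (hI : I.card = k)
    (e : Fin k → Fin n) (he : Function.Injective e) (heI : ∀ j, e j ∈ I) :
    polarAt Q a I = Q fun j => a (e j) := by
  obtain ⟨σ, hσ⟩ := exists_perm_orderEmbOfFin hI e he heI
  rw [polarAt, dif_pos hI, ← hQ σ]
  congr 1
  ext j : 1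
  simp [hσ]

lemma polarAt_insert {Q : (Fin (k + 1) → Fin d → ℝ) → ℝ} (hQ : IsPermInvariant Q)
    (hI : I.card = k) (hb : b ∉ I) :
    polarAt Q a (insert b I) = polarAt (fixFirst Q (a b)) a I := by
  have hmem : ∀ j, I.orderEmbOfFin hI j ∈ I := I.orderEmbOfFin_mem hI
  rw [polarAt_eq hQ (by rw [Finset.card_insert_of_notMem hb, hI])
    (Fin.cons (α := fun _ => Fin n) b (I.orderEmbOfFin hI))
    (Fin.cons_injective_iff.2 ⟨fun ⟨j, hj⟩ => hb (hj ▸ hmem j), (I.orderEmbOfFin hI).injective⟩)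
    (fun j => by cases j using Fin.cases <;> simp [hmem]), polarAt, dif_pos hI, fixFirst]
  congr 1
  ext j : 1
  cases j using Fin.cases <;> rfl

lemma sum_mul_polarAt_insert {Q : (Fin (k + 1) → Fin d → ℝ) → ℝ} (hQ : IsPermInvariant Q)
    (hA : IsMultiaffine Q) (hI : I.card = k) (hIB : Disjoint I B) {c : Fin n → ℝ}
    {x : Fin d → ℝ} (hc : IsLiftRep a B c (projLift x)) :
    ∑ b ∈ B, c b * polarAt Q a (insert b I) = polarAt (fixFirst Q x) a I := by
  obtain ⟨hx, hc1⟩ := liftComb_eq_projLift_iff.1 hc.map_eq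
  set p : Fin k → Fin d → ℝ := fun j => a (I.orderEmbOfFin hI j)
  have haffine : ∀ (y z : Fin d → ℝ) (s : ℝ), fixFirst Q ((1 - s) • y + s • z) p =
      (1 - s) * fixFirst Q y p + s * fixFirst Q z p := fun y z s => by
    simpa only [fixFirst, Fin.update_cons_zero] using hA (Fin.cons 0 p) 0 y z s
  have hpolar : ∀ y, polarAt (fixFirst Q y) a I = fixFirst Q y p := fun y => dif_pos hI
  calc ∑ b ∈ B, c b * polarAt Q a (insert b I)
      = ∑ b ∈ B, c b * fixFirst Q (a b) p := Finset.sum_congr rfl fun b hb => by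
        rw [polarAt_insert hQ hI (Finset.disjoint_right.1 hIB hb), hpolar]
    _ = ∑ b, c b * fixFirst Q (a b) p := hc.sum_eq fun b => fixFirst Q (a b) p
    _ = polarAt (fixFirst Q x) a I := by
      rw [hpolar, ← hx]
      exact (map_sum_smul_of_affine (f := fun y => fixFirst Q y p) haffine _ c a hc1).symm

end PolarAt

/-- `f` is the diagonal of a multiaffine function of `k` arguments. -/
def IsMultiaffineDiag (k : ℕ) (f : (Fin d → ℝ) → ℝ) : Prop :=
  ∃ R : (Fin k → Fin d → ℝ) → ℝ, IsMultiaffine R ∧ ∀ x, R (fun _ => x) = f x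

lemma isMultiaffineDiag_const (r : ℝ) : IsMultiaffineDiag (d := d) k fun _ => r :=
  ⟨fun _ => r, fun _ _ _ _ _ => by ring, fun _ => rfl⟩

lemma IsMultiaffineDiag.mul_coord {f : (Fin d → ℝ) → ℝ} (hf : IsMultiaffineDiag k f)
    (i : Fin d) : IsMultiaffineDiag (k + 1) fun x => f x * x i := by
  obtain ⟨R, hR, hRf⟩ := hf
  refine ⟨fun p => R (Fin.tail p) * p 0 i, fun p j y z s => ?_, fun x => ?_⟩
  · cases j using Fin.cases with
    | zero =>
      simp only [Fin.tail_update_zero, Function.update_self, Pi.add_apply, Pi.smul_apply,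
        smul_eq_mul]
      ring
    | succ j =>
      simp only [Fin.tail_update_succ, hR (Fin.tail p) j y z s,
        Function.update_of_ne (Fin.succ_ne_zero j).symm]
      ring
  · exact congrArg (· * x i) (hRf x)

lemma isMultiaffineDiag_monomial (m : Fin d →₀ ℕ) (r : ℝ) (hm : m.degree ≤ k) :
    IsMultiaffineDiag k fun x => MvPolynomial.eval x (MvPolynomial.monomial m r) := by
  induction k generalizing m with
  | zero =>
    rw [Nat.le_zero, Finsupp.degree_eq_zero_iff] at hm
    simpa [hm] using isMultiaffineDiag_const r
  | succ k ih =>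
    rcases eq_or_ne m 0 with rfl | h0
    · simpa using isMultiaffineDiag_const r
    obtain ⟨i, hi⟩ := Finsupp.ne_iff.1 h0
    obtain ⟨m, rfl⟩ := exists_add_of_le (Finsupp.single_le_iff.2 (Nat.one_le_iff_ne_zero.2 hi))
    rw [map_add, Finsupp.degree_single] at hm
    convert (ih m (by omega)).mul_coord i using 2 with x
    rw [add_comm, ← mul_one r, ← MvPolynomial.monomial_mul, map_mul, mul_one]
    exact congrArg _ (MvPolynomial.eval_X i)

lemma isMultiaffineDiag_sum {ι : Type*} {S : Finset ι} {f : ι → (Fin d → ℝ) → ℝ}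
    (hf : ∀ i ∈ S, IsMultiaffineDiag k (f i)) :
    IsMultiaffineDiag k fun x => ∑ i ∈ S, f i x := by
  choose! R hR hRf using hf
  refine ⟨fun p => ∑ i ∈ S, R i p, fun p j y z s => ?_,
    fun x => Finset.sum_congr rfl fun i hi => hRf i hi x⟩
  rw [Finset.mul_sum, Finset.mul_sum, ← Finset.sum_add_distrib]
  exact Finset.sum_congr rfl fun i hi => hR i hi p j y z s

lemma isMultiaffineDiag_eval (q : MvPolynomial (Fin d) ℝ) (hq : q.totalDegree ≤ k) :
    IsMultiaffineDiag k fun x => MvPolynomial.eval x q := by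
  have h := isMultiaffineDiag_sum (k := k) (S := q.support)
    (f := fun m x => MvPolynomial.eval x (MvPolynomial.monomial m (q.coeff m)))
    fun m hm => isMultiaffineDiag_monomial m _ ((MvPolynomial.le_totalDegree hm).trans hq)
  have hsum : ∀ x, ∑ m ∈ q.support, MvPolynomial.eval x (MvPolynomial.monomial m (q.coeff m)) =
      MvPolynomial.eval x q := fun x => by
    rw [← map_sum (MvPolynomial.eval x), MvPolynomial.support_sum_monomial_coeff]
  simpa only [hsum] using h

lemma IsMultiaffineDiag.exists_isPermInvariant {f : (Fin d → ℝ) → ℝ}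
    (hf : IsMultiaffineDiag k f) :
    ∃ Q : (Fin k → Fin d → ℝ) → ℝ, IsPermInvariant Q ∧ IsMultiaffine Q ∧
      ∀ x, Q (fun _ => x) = f x := by
  obtain ⟨R, hR, hRf⟩ := hf
  refine ⟨fun p => (k.factorial : ℝ)⁻¹ * ∑ σ : Equiv.Perm (Fin k), R (p ∘ σ),
    fun τ p => ?_, fun p j y z s => ?_, fun x => ?_⟩
  · have hsum : ∑ σ : Equiv.Perm (Fin k), R ((p ∘ τ) ∘ σ) = ∑ σ : Equiv.Perm (Fin k), R (p ∘ σ) :=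
      Fintype.sum_equiv (Equiv.mulLeft τ) _ _ fun σ => rfl
    simp only [hsum]
  · simp only [Function.update_comp_equiv, hR _ _ y z s, Finset.sum_add_distrib,
      ← Finset.mul_sum]
    ring
  · have hdiag : ∀ σ : Equiv.Perm (Fin k), R ((fun _ => x) ∘ σ) = f x := fun _ => hRf x
    simp only [hdiag, Finset.sum_const, Finset.card_univ, Fintype.card_perm, Fintype.card_fin,
      nsmul_eq_mul]
    rw [inv_mul_cancel_left₀ (by positivity)]

theorem exists_isPolarForm (q : MvPolynomial (Fin d) ℝ) (hq : q.totalDegree ≤ k) :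
    ∃ Q, IsPolarForm k q Q := by
  obtain ⟨Q, hsymm, haffine, hdiag⟩ := (isMultiaffineDiag_eval q hq).exists_isPermInvariant
  exact ⟨Q, hsymm, haffine, hdiag⟩

end PolarForms

section Volume
open MeasureTheory
variable {d n : ℕ}

lemma volume_real_tileSet (a : Fin n → Fin d → ℝ) (I : Finset (Fin n)) {B : Finset (Fin n)}
    (hB : B.card = d + 1) : volume.real (tileSet a I B) = detPos a B := by
  have hvol : (Pi.basisFun ℝ (Fin (d + 1))).addHaar = volume := by
    rw [Module.Basis.addHaar_eq_iff, Module.Basis.parallelepiped_basisFun,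
      ← addHaarMeasure_eq_volume_pi]
    exact Measure.addHaarMeasure_self
  have hsum : ∑ b ∈ B, segment ℝ 0 (projLift (a b)) =
      parallelepiped fun j => projLift (a (B.orderEmbOfFin hB j)) := by
    rw [parallelepiped_eq_sum_segment]
    conv_lhs => rw [← Finset.map_orderEmbOfFin_univ B hB, Finset.sum_map]
    rfl
  rw [tileSet, hsum, Set.singleton_add, Set.image_add_left, measureReal_def,
    measure_preimage_add, ← hvol, Measure.addHaar_parallelepiped, Pi.basisFun_det,
    ENNReal.toReal_ofReal (abs_nonneg _), detPos, rowDet, dif_pos hB]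
  rfl

lemma volume_knotSet (a : Fin n → Fin d → ℝ) : volume (knotSet a) = 0 :=
  measure_iUnion_null fun C => addHaar_convexHull_image_eq_zero volume a (by simpa using C.2)

lemma hull_subset_closure_diff_knotSet {a : Fin n → Fin d → ℝ}
    (hspan : affineSpan ℝ (Set.range a) = ⊤) : hull a ⊆ closure (hull a \ knotSet a) :=
  subset_closure_diff_of_convex_of_measure_zero volume (convex_convexHull ℝ _)
    (interior_convexHull_nonempty_iff_affineSpan_eq_top.2 hspan) (volume_knotSet a)

end Volume

section Triangulation
variable {d n : ℕ} {a : Fin n → Fin d → ℝ} {I B : Finset (Fin n)} {c : Fin n → ℝ} {x : Fin d → ℝ}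
  {P : Finset (Finset (Fin n) × Finset (Fin n))}

lemma IsLiftRep.le_one (hcx : IsLiftRep a B c (projLift x)) (hc : 0 ≤ c) (i : Fin n) :
    c i ≤ 1 := by
  rw [← (liftComb_eq_projLift_iff.1 hcx.map_eq).2]
  exact Finset.single_le_sum (fun i _ => hc i) (Finset.mem_univ i)

lemma half_smul_mem_tileCube (hc : 0 ≤ c) (hcx : IsLiftRep a B c (projLift x)) :
    (1 / 2 : ℝ) • c ∈ tileCube ∅ B := by
  refine mem_tileCube_iff.2 ⟨by simp, fun i _ => ?_, fun i _ hi => ?_⟩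
  · have h0 := hc i
    have h1 := hcx.le_one hc i
    simp only [Pi.zero_apply, Pi.smul_apply, smul_eq_mul, Set.mem_Icc] at h0 ⊢
    constructor <;> linarith
  · simp [hcx.zero_of_notMem i hi]

lemma half_smul_mem_openTileCube (hx : x ∉ knotSet a) (hB : B.card ≤ d + 1) (hc : 0 ≤ c)
    (hcx : IsLiftRep a B c (projLift x)) : (1 / 2 : ℝ) • c ∈ openTileCube ∅ B := by
  have hcube := half_smul_mem_tileCube hc hcx
  refine ⟨hcube, fun b hb => ?_⟩
  have hpos := pos_of_notMem_knotSet hx hB hc hcx hb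
  have hle := hcx.le_one hc b
  simp only [Pi.smul_apply, smul_eq_mul, Set.mem_Ioo]
  constructor <;> linarith

-- At height `1 / 2` rather than `1` the coordinates stay below `1`, even when `d = 0`.
lemma half_smul_projLift_mem_tileSet_iff :
    (1 / 2 : ℝ) • projLift x ∈ tileSet a ∅ B ↔ x ∈ convexHull ℝ (a '' (B : Set (Fin n))) := by
  rw [tileSet_eq_image a (Finset.disjoint_empty_left B), mem_convexHull_image_iff]
  constructor
  · rintro ⟨c, hc, hcx⟩
    obtain ⟨-, h01, h0⟩ := mem_tileCube_iff.1 hc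
    have hrep : IsLiftRep a B c ((1 / 2 : ℝ) • projLift x) := ⟨fun i => h0 i (by simp), hcx⟩
    refine ⟨(2 : ℝ) • c, smul_nonneg zero_le_two fun i => ?_, by simpa using hrep.smul 2⟩
    by_cases hi : i ∈ B
    · exact (h01 i hi).1
    · exact (hrep.zero_of_notMem i hi).ge
  · rintro ⟨c, hc, hcx⟩
    exact ⟨_, half_smul_mem_tileCube hc hcx, (hcx.smul _).map_eq⟩

lemma eq_empty_of_half_smul_projLift_mem_tileSet (hIB : Disjoint I B)
    (hx : (1 / 2 : ℝ) • projLift x ∈ tileSet a I B) : I = ∅ := by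
  rw [tileSet_eq_image a hIB] at hx
  obtain ⟨c, hc, hcx⟩ := hx
  have hc0 : 0 ≤ c := le_trans (Set.indicator_nonneg fun _ _ => zero_le_one) hc.1
  have hsum : ∑ i, c i = 1 / 2 := by
    simpa [liftComb_apply] using congrFun hcx (Fin.last d)
  refine Finset.eq_empty_of_forall_notMem fun i hi => ?_
  have hle := Finset.single_le_sum (fun i _ => hc0 i) (Finset.mem_univ i)
  rw [(mem_tileCube_iff.1 hc).1 i hi, hsum] at hle
  norm_num at hle

theorem IsFineZonotopalTiling.existsUnique_simplex (hP : IsFineZonotopalTiling a P)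
    (hx : x ∈ hull a) (hxK : x ∉ knotSet a) :
    ∃! B, (∅, B) ∈ P ∧ x ∈ convexHull ℝ (a '' (B : Set (Fin n))) := by
  have hZ : (1 / 2 : ℝ) • projLift x ∈ zonotope a := by
    rwa [zonotope_eq_tileSet, half_smul_projLift_mem_tileSet_iff, ← hull_eq]
  obtain ⟨⟨I, B⟩, ht, hxt⟩ := hP.exists_mem_tileSet hZ
  obtain rfl := eq_empty_of_half_smul_projLift_mem_tileSet (hP.tile _ ht).1 hxt
  have hxB := half_smul_projLift_mem_tileSet_iff.1 hxt
  refine ⟨B, ⟨ht, hxB⟩, fun C ⟨hs, hxC⟩ => ?_⟩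
  obtain ⟨c, hc, hcx⟩ := mem_convexHull_image_iff.1 hxB
  have hopen := half_smul_mem_openTileCube hxK (hP.tile _ ht).2.1.le hc hcx
  refine congrArg Prod.snd (hP.eq_of_mem_openTileCube hs ht hopen ?_)
  rw [map_smul, hcx.map_eq]
  exact half_smul_projLift_mem_tileSet_iff.2 hxC

end Triangulation

section Reproduction
variable {d n k : ℕ} {a : Fin n → Fin d → ℝ} {β : Finset (Fin n) → Finset (Fin n)}
  {I B : Finset (Fin n)} {x : Fin d → ℝ} {P : Finset (Finset (Fin n) × Finset (Fin n))}

theorem IsFineZonotopalTiling.tileSplineSum_zero (hP : IsFineZonotopalTiling a P)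
    (β : Finset (Fin n) → Finset (Fin n)) (hx : x ∈ hull a) (hxK : x ∉ knotSet a)
    (Q : (Fin 0 → Fin d → ℝ) → ℝ) : tileSplineSum a β P 0 Q x = Q fun _ => x := by
  obtain ⟨B, ⟨ht, hxB⟩, huniq⟩ := hP.existsUnique_simplex hx hxK
  have hB := (hP.tile _ ht).2
  have hQ : polarAt Q a ∅ = Q fun _ => x := by
    rw [polarAt, dif_pos Finset.card_empty]
    exact congrArg Q (Subsingleton.elim _ _)
  rw [tileSplineSum, Finset.sum_eq_single (∅, B)]
  · rw [volume_real_tileSet a _ hB.1, Finset.empty_union, simplexSpline_zero_of_mem β hB hxB, hQ,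
      zero_add, Nat.factorial_zero, Nat.cast_one]
    have hdet := hB.detPos_pos.ne'
    field_simp
  · rintro ⟨I, C⟩ hs hne
    obtain ⟨hsP, hcard⟩ := Finset.mem_filter.1 hs
    obtain rfl := Finset.card_eq_zero.1 hcard
    rw [Finset.empty_union, simplexSpline_zero_of_notMem β, mul_zero]
    exact fun hxC => hne (congrArg (Prod.mk ∅) (huniq C ⟨hsP, hxC⟩))
  · exact fun h => absurd (Finset.mem_filter.2 ⟨ht, Finset.card_empty⟩) h

lemma detPos_mul_simplexSpline_succ (hβ : IsBasisChoice a β) (hx : x ∉ knotSet a)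
    (hIB : Disjoint I B) (hI : I.card = k + 1) (hB : IsAffBasis a B) :
    detPos a B * simplexSpline a β (k + 1) (I ∪ B) x =
      (((k + 1 : ℕ) : ℝ) + d) / ((k + 1 : ℕ) : ℝ) *
        ∑ b ∈ B, simplexSpline a β k (I ∪ B.erase b) x * detReplace a B b x := by
  obtain ⟨c, hc⟩ := hB.exists_isLiftRep (projLift x)
  have hcard : (I ∪ B).card = k + d + 2 := by
    rw [Finset.card_union_of_disjoint hIB, hI, hB.1]
    omega
  rw [simplexSpline_succ_eq hβ hx hcard (hc.mono Finset.subset_union_right), mul_left_comm]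
  congr 1
  rw [Finset.mul_sum]
  calc ∑ i, detPos a B * (c i * simplexSpline a β k ((I ∪ B).erase i) x)
      = ∑ i, c i • (detPos a B * simplexSpline a β k ((I ∪ B).erase i) x) :=
        Finset.sum_congr rfl fun i _ => mul_left_comm _ _ _
    _ = ∑ b ∈ B, c b • (detPos a B * simplexSpline a β k ((I ∪ B).erase b) x) :=
        (hc.sum_eq _).symm
    _ = ∑ b ∈ B, simplexSpline a β k (I ∪ B.erase b) x * detReplace a B b x :=
        Finset.sum_congr rfl fun b hb => by
          rw [hc.detReplace_eq hb, Finset.erase_union_distrib,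
            Finset.erase_eq_of_notMem (Finset.disjoint_right.1 hIB hb), smul_eq_mul]
          ring

lemma sum_polarAt_insert_mul_detReplace {Q : (Fin (k + 1) → Fin d → ℝ) → ℝ}
    (hQ : IsPermInvariant Q) (hA : IsMultiaffine Q) (hIB : Disjoint I B) (hI : I.card = k)
    (hB : IsAffBasis a B) (x : Fin d → ℝ) :
    ∑ b ∈ B, polarAt Q a (insert b I) * detReplace a B b x =
      polarAt (fixFirst Q x) a I * detPos a B := by
  obtain ⟨c, hc⟩ := hB.exists_isLiftRep (projLift x)
  rw [← sum_mul_polarAt_insert hQ hA hI hIB hc, Finset.sum_mul]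
  refine Finset.sum_congr rfl fun b hb => ?_
  rw [hc.detReplace_eq hb]
  ring

lemma factorial_div_factorial_succ (k d : ℕ) :
    ((k + 1).factorial : ℝ) / ((k + 1 + d).factorial : ℝ) *
      ((((k + 1 : ℕ) : ℝ) + d) / ((k + 1 : ℕ) : ℝ)) = k.factorial / (k + d).factorial := by
  rw [Nat.add_right_comm k 1 d, Nat.factorial_succ, Nat.factorial_succ]
  push_cast
  field_simp
  ring

theorem IsFineZonotopalTiling.tileSplineSum_succ (hP : IsFineZonotopalTiling a P)
    (hβ : IsBasisChoice a β) (hx : x ∉ knotSet a) (hrep : VerticesRepeated a (k + 2))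
    {Q : (Fin (k + 1) → Fin d → ℝ) → ℝ} (hQ : IsPermInvariant Q) (hA : IsMultiaffine Q) :
    tileSplineSum a β P (k + 1) Q x = tileSplineSum a β P k (fixFirst Q x) x := by
  set H : Finset (Fin n) → Finset (Fin n) → ℝ := fun J C =>
    polarAt Q a J * simplexSpline a β k (J ∪ C) x with hH
  have hlower : ∀ t ∈ P.filter fun t => t.1.card = k + 1,
      polarAt Q a t.1 * MeasureTheory.volume.real (tileSet a t.1 t.2) *
          simplexSpline a β (k + 1) (t.1 ∪ t.2) x =
        (((k + 1 : ℕ) : ℝ) + d) / ((k + 1 : ℕ) : ℝ) *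
          ∑ b ∈ t.2, H t.1 (t.2.erase b) * detReplace a t.2 b x := fun t ht => by
    obtain ⟨htP, htk⟩ := Finset.mem_filter.1 ht
    obtain ⟨hd, hB⟩ := hP.tile t htP
    rw [volume_real_tileSet a _ hB.1, mul_assoc, detPos_mul_simplexSpline_succ hβ hx hd htk hB,
      mul_left_comm, Finset.mul_sum]
    simp only [hH, mul_assoc]
  have hupper : ∀ t ∈ P.filter fun t => t.1.card = k,
      ∑ b ∈ t.2, H (insert b t.1) (t.2.erase b) * detReplace a t.2 b x =
        polarAt (fixFirst Q x) a t.1 * MeasureTheory.volume.real (tileSet a t.1 t.2) *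
          simplexSpline a β k (t.1 ∪ t.2) x := fun t ht => by
    obtain ⟨htP, htk⟩ := Finset.mem_filter.1 ht
    obtain ⟨hd, hB⟩ := hP.tile t htP
    rw [volume_real_tileSet a _ hB.1, ← sum_polarAt_insert_mul_detReplace hQ hA hd htk hB,
      Finset.sum_mul]
    refine Finset.sum_congr rfl fun b hb => ?_
    simp only [hH]
    rw [Finset.insert_union, ← Finset.union_insert, Finset.insert_erase hb, mul_right_comm]
  rw [tileSplineSum, tileSplineSum, Finset.sum_congr rfl hlower, ← Finset.mul_sum, ← mul_assoc,
    factorial_div_factorial_succ, hP.sum_mul_detReplace_exchange hrep _ x,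
    Finset.sum_congr rfl hupper]
  exact fun J C hJC => by simp only [hH, simplexSpline_eq_zero β k hJC, mul_zero]

theorem IsFineZonotopalTiling.tileSplineSum_eq (hP : IsFineZonotopalTiling a P)
    (hβ : IsBasisChoice a β) (hx : x ∈ hull a) (hxK : x ∉ knotSet a)
    (hrep : VerticesRepeated a (k + 1)) {Q : (Fin k → Fin d → ℝ) → ℝ} (hQ : IsPermInvariant Q)
    (hA : IsMultiaffine Q) : tileSplineSum a β P k Q x = Q fun _ => x := by
  induction k with
  | zero => exact hP.tileSplineSum_zero β hx hxK Q
  | succ k ih =>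
    rw [hP.tileSplineSum_succ hβ hxK hrep hQ hA,
      ih (fun p hp => (Nat.le_succ _).trans (hrep p hp)) (hQ.fixFirst x) (hA.fixFirst x),
      fixFirst_diag]

end Reproduction

theorem corollary1 {d n : ℕ} (a : Fin n → Fin d → ℝ)
    (hspan : affineSpan ℝ (Set.range a) = ⊤)
    (P : Finset (Finset (Fin n) × Finset (Fin n))) (hP : IsFineZonotopalTiling a P)
    (k : ℕ)
    (hrep : ∀ p ∈ (hull a).extremePoints ℝ,
      k + 1 ≤ (Finset.univ.filter (fun i : Fin n => a i = p)).card)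
    (β : Finset (Fin n) → Finset (Fin n)) (hβ : IsBasisChoice a β) :
    MeasureTheory.volume (knotSet a) = 0 ∧
    hull a ⊆ closure (hull a \ knotSet a) ∧
    ∀ q : MvPolynomial (Fin d) ℝ, q.totalDegree ≤ k →
      ∃ Q : (Fin k → Fin d → ℝ) → ℝ, IsPolarForm k q Q ∧
        (∀ x ∈ hull a \ knotSet a,
          MvPolynomial.eval x q = tileSplineSum a β P k Q x) ∧
        (∀ x ∈ hull a,
          Filter.Tendsto (tileSplineSum a β P k Q) (nhdsWithin x (hull a \ knotSet a))
            (nhds (MvPolynomial.eval x q))) := by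
  refine ⟨volume_knotSet a, hull_subset_closure_diff_knotSet hspan, fun q hq => ?_⟩
  obtain ⟨Q, hQ⟩ := exists_isPolarForm q hq
  have heq : ∀ x ∈ hull a \ knotSet a, MvPolynomial.eval x q = tileSplineSum a β P k Q x :=
    fun x hx => by
      rw [hP.tileSplineSum_eq hβ hx.1 hx.2 hrep hQ.symm hQ.affine, hQ.diag]
  refine ⟨Q, hQ, heq, fun x _ => ?_⟩
  have hcont : Filter.Tendsto (fun y => MvPolynomial.eval y q)
      (nhdsWithin x (hull a \ knotSet a)) (nhds (MvPolynomial.eval x q)) :=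
    ((MvPolynomial.continuous_eval q).tendsto x).mono_left nhdsWithin_le_nhds
  exact hcont.congr' (Filter.eventually_of_mem self_mem_nhdsWithin heq)
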